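/- **Setting.** Let $X$ be a smooth real Banach manifold and let $\kappa\colon X\times X\to\mathbb C$ be a smooth positive definite kernel, i.e. $\sum_{i,j}\kappa(x_i,x_j)v_j\overline{v_i}\ge 0$ for all finite families $x_i\in X$, $v_i\in\mathbb C$, with $\kappa(x,x)\ne0$ for all $x\in X$. Let $\mathcal H^\kappa$ be the reproducing kernel Hilbert space of $\kappa$, put $\kappa_x=\kappa(\cdot,x)\in\mathcal H^\kappa$, $\zeta(x)=\mathbb C\kappa_x\in\mathrm{Gr}(\mathcal H^\kappa)$ and $\delta(x,z)=(\zeta(x),z\kappa_x)$, a map from the trivial line bundle $X\times\mathbb C$ into the tautological bundle $\mathcal T(\mathcal H^\kappa)=\{(\mathcal S,h):\mathcal S\in\mathrm{Gr}(\mathcal H^\kappa),\ h\in\mathcal S\}$. A *connection* on a bundle $\varphi\colon M\to X$ is a smooth idempotent endomorphism $\Phi$ of the tangent bundle $TM$ over $\mathrm{id}_M$ whose range at each point is the kernel of $T\varphi$. On the tautological bundle of a Hilbert space $\mathcal H$, over the component $\{u\mathcal S_0: u\in U(\mathcal H)\}$ and in the description $U(\mathcal H)\times_{U(p)}\mathcal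 S_0$ (with $p$ the orthogonal projection onto $\mathcal S_0$ and $U(p)$ the group of unitaries $u$ with $u\mathcal S_0=\mathcal S_0$), the *universal connection* is $[((u,A),(h,k))]\mapsto[((u,0),(h,E_p(A)h+k))]$, where $E_p(A)=pAp+(1-p)A(1-p)$. The *connection induced by $\kappa$* is the pull-back of the universal connection through $(\delta,\zeta)$, i.e. the connection $\Phi$ on $X\times\mathbb C\to X$ for which $T\delta\circ\Phi$ equals the universal connection composed with $T\delta$. The *covariant derivative* of a linear connection $\Phi$ is $\nabla\sigma=r\circ\Phi\circ T\sigma$ for smooth (locally defined) sections $\sigma$, where $r$ is the natural map from vertical tangent vectors to the total space $X\times\mathbb C$. **Proposition.** The maps $\zeta$ and $\delta$ are smooth, $\delta$ is a linear isomorphism from each fibre onto the corresponding fibre, and the connection induced by $\kappa$ exists, is unique and is linear. Its covariant derivative satisfies, for every smooth section $\sigma(\cdot)=(\cdot,F(\cdot))$ and every $x$ in its domain, $$(\nabla\sigma)_x=\Bigl(x,\ (\mathrm dF)_x+F(x)\,\frac{\partial_2\kappa(x,x)}{\kappa(x,x)}\Bigr),$$ that is, $\nabla F=\mathrm dF+\alpha_\kappa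 F$, where $\alpha_\kappa$ is the smooth complex-valued $1$-form $(\alpha_\kappa)_x=\partial_2\kappa(x,x)/\kappa(x,x)$. The following kernels satisfy the hypotheses (powers are principal branches), and for them $\alpha_\kappa$ is as given: 1. For $\nu\ge1$ and $\kappa(s,t)=(1-\overline t s)^{-\nu}$ on the unit disk (Hardy kernel for $\nu=1$, Bergman kernels for $\nu>1$): $\ (\alpha_\kappa)_s(\lambda)=\dfrac{\nu s}{1-|s|^2}\,\overline\lambda$. 2. For $\nu\ge1$ and $\kappa(z,w)=\frac14(2i)^\nu(z-\overline w)^{-\nu}$ on the upper half-plane (Hardy kernel for $\nu=1$, Bergman kernels for $\nu>1$): $\ (\alpha_\kappa)_z(\lambda)=\dfrac{\nu}{2i\,\operatorname{Im}z}\,\overline\lambda$. 3. For $\kappa(z,w)=\exp\bigl(\sum_{j=1}^n z_j\overline{w_j}\bigr)$ on $\mathbb C^n$ (Fock kernel): $\ (\alpha_\kappa)_z(\lambda)=\sum_{j=1}^n z_j\overline{\lambda_j}$. -/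

import Mathlib

open scoped Manifold ContDiff ComplexConjugate ComplexOrder

noncomputable section

namespace KernelConnection

/-! ### The tautological bundle of a complex Hilbert space and its universal connection

The Grassmann manifold `Gr(H)` is the set `ClosedSubmodule ℂ H` of all closed subspaces of `H`. Its
smooth structure is the one it has as the submanifold of all orthogonal projections in the Banach
space of bounded operators, a subspace `S` being identified with the orthogonal projection onto it.
Accordingly the tautological bundle is a submanifold of `B(H) × H`, and tangent vectors to it are
pairs consisting of a base point and a velocity in `B(H) × H`. -/

section Tautological

variable {H : Type*} [NormedAddCommGroup H] [InnerProductSpace ℂ H] [CompleteSpace H]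

/-- The orthogonal projection of `H` onto the closed subspace `S`, as a bounded operator on `H`. -/
def proj (S : ClosedSubmodule ℂ H) : H →L[ℂ] H :=
  S.toSubmodule.starProjection

variable (H) in
/-- The total space `{(S, x) : x ∈ S}` of the tautological bundle over the Grassmann manifold. -/
@[ext]
structure Taut where
  base : ClosedSubmodule ℂ H
  vec : H
  mem : vec ∈ base

/-- The embedding `(S, x) ↦ (p_S, x)` of the tautological bundle in the Banach space `B(H) × H`. -/
def Taut.emb (τ : Taut H) : (H →L[ℂ] H) × H :=
  (proj τ.base, τ.vec)

variable (H) in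
/-- Tangent vectors to the tautological bundle, described by base point and velocity. -/
abbrev TautTangent : Type _ := Taut H × ((H →L[ℂ] H) × H)

/-- The action `u (S, x) = (u S, u x)` of the unitary group on the tautological bundle. -/
def Taut.move (u : unitary (H →L[ℂ] H)) (τ : Taut H) : Taut H :=
  ⟨τ.base.mapEquiv (Unitary.linearIsometryEquiv u).toContinuousLinearEquiv,
    (u : H →L[ℂ] H) τ.vec,
    (ClosedSubmodule.mem_mapEquiv_iff'
      (f := (Unitary.linearIsometryEquiv u).toContinuousLinearEquiv) τ.base τ.vec).2 τ.mem⟩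

/-- The one-parameter group `t ↦ exp (t X)` of unitary operators generated by a skew-adjoint
operator `X`, that is, by an element `X` of the Lie algebra of the unitary group. -/
def expUnitary (X : skewAdjoint (H →L[ℂ] H)) (t : ℝ) : unitary (H →L[ℂ] H) :=
  ⟨NormedSpace.exp (t • (X : H →L[ℂ] H)), by
    let _ : NormedAlgebra ℚ (H →L[ℂ] H) := NormedAlgebra.restrictScalars ℚ ℂ _
    exact NormedSpace.exp_mem_unitary_of_mem_skewAdjoint (skewAdjoint.smul_mem t X.2)⟩

/-- The curve `t ↦ (u exp (t X) S₀, u exp (t X) (x + t y))` in the tautological bundle. -/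
def classCurve (S₀ : ClosedSubmodule ℂ H) (u : unitary (H →L[ℂ] H))
    (X : skewAdjoint (H →L[ℂ] H)) (x y : S₀) (t : ℝ) : Taut H :=
  Taut.move (u * expUnitary X t)
    ⟨S₀, (x : H) + (t : ℂ) • (y : H), add_mem x.2 (S₀.smul_mem (t : ℂ) y.2)⟩

/-- The tangent vector `[((u, X), (x, y))]` to the tautological bundle over the connected component
`{u S₀ : u unitary}` of the Grassmann manifold, this bundle being the homogeneous vector bundle
`U(H) ×_{U(p)} S₀` under `[(u, x)] ↦ (u S₀, u x)`. The Lie algebra element `X` stands for the tangent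
vector to `U(H)` at `u` that is the velocity of `t ↦ u exp (t X)`. -/
def tangentClass (S₀ : ClosedSubmodule ℂ H) (u : unitary (H →L[ℂ] H))
    (X : skewAdjoint (H →L[ℂ] H)) (x y : S₀) : TautTangent H :=
  (classCurve S₀ u X x y 0, deriv (fun t : ℝ => (classCurve S₀ u X x y t).emb) 0)

/-- The conditional expectation `E_p(X) = p X p + (1 - p) X (1 - p)`. -/
def condExpectation (p X : H →L[ℂ] H) : H →L[ℂ] H :=
  p * X * p + (1 - p) * X * (1 - p)

/-- The graph of the universal connection of the tautological bundle: over the component of each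
`S₀` it is the map `[((u, X), (x, y))] ↦ [((u, 0), (x, E_p(X) x + y))]`, where `p` is the orthogonal
projection onto `S₀`. That this is single-valued, and independent of the choice of `S₀` in its
component, is `UniversalConnection.unique`. -/
def UniversalConnection (v w : TautTangent H) : Prop :=
  ∃ (S₀ : ClosedSubmodule ℂ H) (u : unitary (H →L[ℂ] H)) (X : skewAdjoint (H →L[ℂ] H))
    (x y y' : S₀),
    (y' : H) = condExpectation (proj S₀) X x + y ∧
      v = tangentClass S₀ u X x y ∧ w = tangentClass S₀ u 0 x y'

theorem proj_move (u : unitary (H →L[ℂ] H)) (τ : Taut H) :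
    proj (τ.move u).base = (u : H →L[ℂ] H) * proj τ.base * star (u : H →L[ℂ] H) := by
  ext h
  exact Submodule.starProjection_map_apply (Unitary.linearIsometryEquiv u) τ.base.toSubmodule h

theorem star_expUnitary (X : skewAdjoint (H →L[ℂ] H)) (t : ℝ) :
    star ((expUnitary X t : unitary (H →L[ℂ] H)) : H →L[ℂ] H) =
      NormedSpace.exp (t • (-(X : H →L[ℂ] H))) := by
  let _ : NormedAlgebra ℚ (H →L[ℂ] H) := NormedAlgebra.restrictScalars ℚ ℂ _
  have hX : star (X : H →L[ℂ] H) = -X := X.2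
  simp [expUnitary, NormedSpace.star_exp, hX]

/-- The class `[((u, X), (x, y))]` is the velocity `(u [X, p] u⁻¹, u (X x + y))` at `(u S₀, u x)`. -/
theorem tangentClass_eq (S₀ : ClosedSubmodule ℂ H) (u : unitary (H →L[ℂ] H))
    (X : skewAdjoint (H →L[ℂ] H)) (x y : S₀) :
    tangentClass S₀ u X x y =
      (Taut.move u ⟨S₀, x, x.2⟩,
        ((u : H →L[ℂ] H) * ((X : H →L[ℂ] H) * proj S₀ - proj S₀ * X) * star (u : H →L[ℂ] H),
          (u : H →L[ℂ] H) ((X : H →L[ℂ] H) x + y))) := by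
  have h0 : expUnitary X 0 = 1 := by
    ext1
    simp [expUnitary]
  refine Prod.ext ?_ ?_
  · simp [tangentClass, classCurve, h0]
  · refine HasDerivAt.deriv ?_
    have hc : (fun t : ℝ => (classCurve S₀ u X x y t).emb) = fun t : ℝ =>
        ((u : H →L[ℂ] H) * NormedSpace.exp (t • (X : H →L[ℂ] H)) * proj S₀ *
            (NormedSpace.exp (t • (-(X : H →L[ℂ] H))) * star (u : H →L[ℂ] H)),
          ((u : H →L[ℂ] H) * NormedSpace.exp (t • (X : H →L[ℂ] H))) ((x : H) + t • (y : H))) := by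
      funext t
      refine Prod.ext ?_ rfl
      change proj _ = _
      rw [classCurve, proj_move, Submonoid.coe_mul, star_mul, star_expUnitary]
      rfl
    rw [hc]
    have e1 := hasDerivAt_exp_smul_const (𝕂 := ℝ) (X : H →L[ℂ] H) (0 : ℝ)
    have e2 := hasDerivAt_exp_smul_const (𝕂 := ℝ) (-(X : H →L[ℂ] H)) (0 : ℝ)
    have e3 : HasDerivAt (fun t : ℝ => (x : H) + t • (y : H)) (y : H) 0 := by
      simpa using ((hasDerivAt_id (0 : ℝ)).smul_const (y : H)).const_add (x : H)
    have e4 := (e1.const_mul (u : H →L[ℂ] H))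
    have e5 := (e4.mul_const (proj S₀)).mul (e2.mul_const (star (u : H →L[ℂ] H)))
    have e6 := (((ContinuousLinearMap.restrictScalarsL ℂ H H ℝ ℝ).hasFDerivAt.comp_hasDerivAt
      (0 : ℝ) e4)).clm_apply e3
    refine (e5.prodMk e6).congr_deriv ?_
    refine Prod.ext ?_ ?_
    · simp
      noncomm_ring
    · simp [add_comm]

theorem condExpectation_apply (S : ClosedSubmodule ℂ H) (X : H →L[ℂ] H) (x : S) :
    condExpectation (proj S) X x = proj S (X x) := by
  have hx : proj S (x : H) = x := Submodule.starProjection_eq_self_iff.2 x.2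
  simp [condExpectation, hx]

theorem proj_apply_coe (S : ClosedSubmodule ℂ H) (x : S) : proj S (x : H) = x :=
  Submodule.starProjection_eq_self_iff.2 x.2

/-- The universal connection sends the velocity `(q, h)` at `(S, x)` to `(0, p_S h)`. -/
theorem UniversalConnection.eq {v w : TautTangent H} (h : UniversalConnection v w) :
    w = (v.1, (0, proj v.1.base v.2.2)) := by
  obtain ⟨S₀, u, X, x, y, y', hy, rfl, rfl⟩ := h
  have hu : star (u : H →L[ℂ] H) * (u : H →L[ℂ] H) = 1 := Unitary.coe_star_mul_self u
  have hu' : ∀ z : H, star (u : H →L[ℂ] H) ((u : H →L[ℂ] H) z) = z := fun z =>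
    congrArg (fun T : H →L[ℂ] H => T z) hu
  simp [tangentClass_eq, proj_move, hy, condExpectation_apply, hu', proj_apply_coe]

theorem UniversalConnection.unique {v w w' : TautTangent H}
    (h : UniversalConnection v w) (h' : UniversalConnection v w') : w = w' :=
  h.eq.trans h'.eq.symm

end Tautological

/-! ### Connections -/

section Connections

variable {B : Type*} [NormedAddCommGroup B] [NormedSpace ℝ B] {L : Type*} [TopologicalSpace L]
  {I : ModelWithCorners ℝ B L} {M : Type*} [TopologicalSpace M] [ChartedSpace L M]

/-- The bundle endomorphism `(Φ, id)` of the tangent bundle given by operators on the fibres. -/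
def onTangent (Φ : ∀ p : M, TangentSpace I p →L[ℝ] TangentSpace I p) (v : TangentBundle I M) :
    TangentBundle I M :=
  ⟨v.1, Φ v.1 v.2⟩

/-- A connection on the fibre bundle `φ : M → Z`: a smooth idempotent endomorphism `Φ` of the tangent
bundle of `M` (over the identity of `M`) whose range at each point is the vertical space. -/
structure IsConnection {B' : Type*} [NormedAddCommGroup B'] [NormedSpace ℝ B'] {L' : Type*}
    [TopologicalSpace L'] (J : ModelWithCorners ℝ B' L') {Z : Type*} [TopologicalSpace Z]
    [ChartedSpace L' Z] [IsManifold I 1 M] (φ : M → Z)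
    (Φ : ∀ p : M, TangentSpace I p →L[ℝ] TangentSpace I p) : Prop where
  smooth : ContMDiff I.tangent I.tangent ∞ (onTangent Φ)
  idem : ∀ (p : M) (v : TangentSpace I p), Φ p (Φ p v) = Φ p v
  range_eq_ker : ∀ p : M, (Φ p).range = (mfderiv I J φ p).ker

end Connections

/-! ### The trivial line bundle `X × ℂ → X` over a Banach manifold `X` -/

section TrivialBundle

variable {E : Type*} [NormedAddCommGroup E] [NormedSpace ℝ E]
  {X : Type*} [TopologicalSpace X] [ChartedSpace E X]

variable (E X) in
/-- Families of operators on the tangent spaces of the total space `X × ℂ`. -/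
abbrev TangentOperators : Type _ :=
  ∀ p : X × ℂ, TangentSpace (𝓘(ℝ, E).prod 𝓘(ℝ, ℂ)) p →L[ℝ]
    TangentSpace (𝓘(ℝ, E).prod 𝓘(ℝ, ℂ)) p

/-- The tangent vector to `X × ℂ` at `(x, z)` with components `ξ` and `w`. -/
def tangentPair (x : X) (ξ : TangentSpace 𝓘(ℝ, E) x) (z w : ℂ) :
    TangentBundle (𝓘(ℝ, E).prod 𝓘(ℝ, ℂ)) (X × ℂ) :=
  (equivTangentBundleProd 𝓘(ℝ, E) X 𝓘(ℝ, ℂ) ℂ).symm (⟨x, ξ⟩, ⟨z, w⟩)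

/-- The natural map `r` from the vertical bundle of `X × ℂ → X` to `X × ℂ`, sending a vertical vector
at `(x, z)` with component `w` in `ℂ`, which is the velocity of `t ↦ (x, z + t w)`, to `(x, w)`. -/
def verticalPart (v : TangentBundle (𝓘(ℝ, E).prod 𝓘(ℝ, ℂ)) (X × ℂ)) : X × ℂ :=
  (v.1.1, (equivTangentBundleProd 𝓘(ℝ, E) X 𝓘(ℝ, ℂ) ℂ v).2.2)

/-- A connection on `X × ℂ → X` is linear if it is linear on the fibres of `T(X × ℂ) → TX`; the
vector space operations of the fibre over `ξ ∈ T_x X` act on the pairs `(z, w) ∈ ℂ × ℂ`. -/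
def IsLinear (Φ : TangentOperators E X) : Prop :=
  ∀ (x : X) (ξ : TangentSpace 𝓘(ℝ, E) x) (c z z' w w' : ℂ),
    (verticalPart (onTangent Φ (tangentPair x ξ (c * z + z') (c * w + w')))).2 =
      c * (verticalPart (onTangent Φ (tangentPair x ξ z w))).2 +
        (verticalPart (onTangent Φ (tangentPair x ξ z' w'))).2

/-- The covariant derivative `∇σ = r ∘ Φ ∘ Tσ` of the section `σ = (·, F(·))`. -/
def covariantDerivative (Φ : TangentOperators E X) (F : X → ℂ) (v : TangentBundle 𝓘(ℝ, E) X) :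
    X × ℂ :=
  verticalPart (onTangent Φ
    (tangentMap 𝓘(ℝ, E) (𝓘(ℝ, E).prod 𝓘(ℝ, ℂ)) (fun x => (x, F x)) v))

/-- The differential `(dF)_x ξ` of a complex-valued function. -/
def differential (F : X → ℂ) (x : X) (ξ : TangentSpace 𝓘(ℝ, E) x) : ℂ :=
  mfderiv 𝓘(ℝ, E) 𝓘(ℝ, ℂ) F x ξ

/-- The covariant derivative of `Φ` is `F ↦ dF + α F`: for every smooth section `(·, F(·))` over an
open set `W`, every `x ∈ W` and every `ξ ∈ T_x X` one has `(∇σ)_x ξ = (x, (dF)_x ξ + F(x) α_x(ξ))`. -/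
def HasCovariantDerivative (Φ : TangentOperators E X)
    (α : ∀ x : X, TangentSpace 𝓘(ℝ, E) x → ℂ) : Prop :=
  ∀ (W : Set X) (F : X → ℂ), IsOpen W → ContMDiffOn 𝓘(ℝ, E) 𝓘(ℝ, ℂ) ∞ F W →
    ∀ x ∈ W, ∀ ξ : TangentSpace 𝓘(ℝ, E) x,
      covariantDerivative Φ F ⟨x, ξ⟩ = (x, differential F x ξ + F x * α x ξ)

/-! ### Scalar reproducing kernels and the connections which they induce -/

/-- The scalar kernel `κ` is positive definite (in the sense that includes semidefinite kernels). -/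
def IsPositiveDefinite {X : Type*} (κ : X → X → ℂ) : Prop :=
  ∀ (n : ℕ) (x : Fin n → X) (v : Fin n → ℂ),
    0 ≤ ∑ i, ∑ j, κ (x i) (x j) * v j * conj (v i)

/-- `κ` is the kernel of the reproducing kernel Hilbert space `H` of functions on `X`, that is,
`κ(x, y) v = (κ_y ⊗ v)(x)`. -/
def IsKernelOf {X : Type*} (κ : X → X → ℂ) (H : Type*) [NormedAddCommGroup H]
    [InnerProductSpace ℂ H] [CompleteSpace H] [RKHS ℂ H X ℂ] : Prop :=
  ∀ (x y : X) (v : ℂ), RKHS.kernel H x y v = κ x y * v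

/-- Smoothness of a kernel on a real Banach manifold modelled on `E`. -/
def IsSmoothKernel (E : Type*) [NormedAddCommGroup E] [NormedSpace ℝ E] {X : Type*}
    [TopologicalSpace X] [ChartedSpace E X] (κ : X → X → ℂ) : Prop :=
  ContMDiff (𝓘(ℝ, E).prod 𝓘(ℝ, E)) 𝓘(ℝ, ℂ) ∞ (fun p : X × X => κ p.1 p.2)

/-- The differential form `(α_κ)_x = ∂₂κ(x, x) / κ(x, x)`. -/
def kernelForm (κ : X → X → ℂ) (x : X) (ξ : TangentSpace 𝓘(ℝ, E) x) : ℂ :=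
  differential (fun y => κ x y) x ξ / κ x x

section Induced

variable (H : Type*) [NormedAddCommGroup H] [InnerProductSpace ℂ H] [CompleteSpace H]

/-- The map `K̂(x, z) = κ_x ⊗ z = κ(·, x) z` from `X × ℂ` to the reproducing kernel Hilbert space. -/
def kernelMap {X : Type*} [RKHS ℂ H X ℂ] (p : X × ℂ) : H :=
  RKHS.kerFun H p.1 p.2

/-- The map `ζ_K : X → Gr(H)` sending `x` to the closure of `K̂({x} × ℂ)`. -/
def lineMap {X : Type*} [RKHS ℂ H X ℂ] (x : X) : ClosedSubmodule ℂ H :=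
  (RKHS.kerFun H x : ℂ →L[ℂ] H).range.closure

/-- The classifying map `δ_K(x, z) = (ζ_K(x), K̂(x, z))` into the tautological bundle. -/
def classifyingMap {X : Type*} [RKHS ℂ H X ℂ] (p : X × ℂ) : Taut H :=
  ⟨lineMap H p.1, kernelMap H p, Submodule.le_topologicalClosure _ ⟨p.2, rfl⟩⟩

/-- The tangent map `Tδ_K`. -/
def tangentClassifyingMap [RKHS ℂ H X ℂ]
    (v : TangentBundle (𝓘(ℝ, E).prod 𝓘(ℝ, ℂ)) (X × ℂ)) : TautTangent H :=
  (classifyingMap H v.1,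
    mfderiv (𝓘(ℝ, E).prod 𝓘(ℝ, ℂ)) 𝓘(ℝ, (H →L[ℂ] H) × H)
      (fun p : X × ℂ => (classifyingMap H p).emb) v.1 v.2)

/-- `Φ` is the connection on the trivial bundle `X × ℂ → X` induced by the kernel of the reproducing
kernel Hilbert space `H`: the classifying morphism `(δ_K, ζ_K)` is smooth and a linear isomorphism
from each fibre onto the corresponding fibre of the tautological bundle, and `Φ` is the pull-back of
the universal connection through it, that is, `Φ` is a connection such that the universal connection
composed with `Tδ_K` equals `Tδ_K` composed with `Φ`. -/
structure IsInducedConnection [IsManifold 𝓘(ℝ, E) ∞ X] [RKHS ℂ H X ℂ]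
    (Φ : TangentOperators E X) : Prop where
  isConnection : IsConnection 𝓘(ℝ, E) (Prod.fst : X × ℂ → X) Φ
  smooth_base : ContMDiff 𝓘(ℝ, E) 𝓘(ℝ, H →L[ℂ] H) ∞ (fun x : X => proj (lineMap H x))
  smooth_total : ContMDiff (𝓘(ℝ, E).prod 𝓘(ℝ, ℂ)) 𝓘(ℝ, (H →L[ℂ] H) × H) ∞
    (fun p : X × ℂ => (classifyingMap H p).emb)
  fibre_bijective : ∀ x : X,
    Set.BijOn (RKHS.kerFun H x : ℂ →L[ℂ] H) Set.univ (lineMap H x : Set H)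
  pullback : ∀ v : TangentBundle (𝓘(ℝ, E).prod 𝓘(ℝ, ℂ)) (X × ℂ),
    UniversalConnection (tangentClassifyingMap H v) (tangentClassifyingMap H (onTangent Φ v))

end Induced

end TrivialBundle

/-! ### Classical kernels -/

/-- The open unit disk, as an open submanifold of `ℂ`. -/
def disk : TopologicalSpace.Opens ℂ := ⟨Metric.ball 0 1, Metric.isOpen_ball⟩

/-- The open upper half-plane, as an open submanifold of `ℂ`. -/
def halfPlane : TopologicalSpace.Opens ℂ :=
  ⟨{z : ℂ | 0 < z.im}, isOpen_lt continuous_const Complex.continuous_im⟩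

/-- The kernel of the Hardy space (`ν = 1`) and of the Bergman spaces (`ν > 1`) on the disk. -/
def diskKernel (ν : ℝ) (s t : disk) : ℂ :=
  1 / (1 - conj (t : ℂ) * (s : ℂ)) ^ (ν : ℂ)

/-- The kernel of the Hardy space (`ν = 1`) and of the Bergman spaces (`ν > 1`) on the upper
half-plane. The powers are principal branches. -/
def halfPlaneKernel (ν : ℝ) (z w : halfPlane) : ℂ :=
  1 / 4 * ((2 * Complex.I) ^ (ν : ℂ) / ((z : ℂ) - conj (w : ℂ)) ^ (ν : ℂ))

/-- The kernel of the Fock space on `ℂⁿ`. -/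
def fockKernel (n : ℕ) (z w : EuclideanSpace ℂ (Fin n)) : ℂ :=
  Complex.exp (∑ j, z j * conj (w j))

end KernelConnection

end

noncomputable section

namespace KernelConnection

/-! ### Smoothness of maps with a smooth Gram kernel -/

section Gram

open Filter Topology

variable {E G Q : Type*} [NormedAddCommGroup E] [NormedSpace ℝ E]
  [NormedAddCommGroup G] [NormedSpace ℝ G] [NormedAddCommGroup Q] [NormedSpace ℝ Q]

/-! The analytic core is that `x ↦ κ_x` is smooth into the Hilbert space although only `κ` is
assumed smooth. By the reproducing property `⟨κ_x, κ_y⟩ = κ(x, y)`, so `κ` is the Gram kernel of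
this map. Let `d` take values in a Banach space with a coercive pairing `β`, that is, `‖g‖² ≤ ‖β g
g‖`, and let its Gram kernel be bilinear to first order. If `∑ c_i v_i = 0` with small `v_i`, expand
`β` at `∑ c_i d(v_i)` in both slots: the bilinear main part cancels and only the error remains
(`norm_sum_smul_le`). The relations among `t v`, `t w`, `t (v + w)` then give existence and
linearity of the derivative of `d`. The derivative of a map with smooth Gram kernel again has a
smooth Gram kernel, the mixed second derivative, for the coercive pairing `operatorPairing`;
induction gives smoothness (`contDiffOn_of_gram`).

Since `κ_x ≠ 0`, the projection onto `ℂ κ_x` is a smooth rank-one expression in `κ_x`, so `ζ` and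
`δ` are smooth. In `B(H) × H` the universal connection is `(q, h) ↦ (0, p_S h)`. Every solution of
the linearized equations of the bundle lies in its domain, represented by the commutator `[P', P]`;
velocities of differentiable maps into the bundle are such solutions.

The vector component of `Tδ(ξ, w)` at `(x, z)` is `w κ_x + z dκ_x(ξ)`. Its projection onto `ℂ κ_x`
is `(w + z α_x(ξ)) κ_x`, which is the image of the vertical vector `(0, w + z α_x(ξ))`. As `κ_x ≠
0`, this both constructs the induced connection and forces its formula
(`IsInducedConnection.apply_eq`); linearity and the covariant derivative are read off.

The disk and Fock kernels are power series with nonnegative coefficients in a Gram kernel, hence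
positive definite. The half-plane kernel is a rescaled Cayley pull-back of the disk kernel. Their
forms are logarithmic derivatives in the conjugate variable. -/

theorem eventually_norm_sub_lt {α F : Type*} [TopologicalSpace α] [SeminormedAddCommGroup F]
    {f : α → F} {x : α} (hf : ContinuousAt f x) {ε : ℝ} (hε : 0 < ε) :
    ∀ᶠ y in 𝓝 x, ‖f y - f x‖ < ε := by
  simpa only [← dist_eq_norm] using hf.eventually (Metric.ball_mem_nhds _ hε)

/-- The second difference of a function of two variables is approximated by its mixed derivative. -/
theorem norm_second_difference_sub_le {K : E × E → Q} {D₁ : E × E → E →L[ℝ] Q}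
    {D₁₂ : E × E → E →L[ℝ] E →L[ℝ] Q} {U : Set E} (hU : IsOpen U)
    (h₁ : ∀ a ∈ U, ∀ b ∈ U, HasFDerivAt (fun v => K (v, b)) (D₁ (a, b)) a)
    (h₂ : ∀ a ∈ U, ∀ b ∈ U, HasFDerivAt (fun w => D₁ (a, w)) (D₁₂ (a, b)) b)
    {x : E} (hx : x ∈ U) (hc : ContinuousAt D₁₂ (x, x)) {ε : ℝ} (hε : 0 < ε) :
    ∃ δ > 0, ∀ v w : E, ‖v‖ < δ → ‖w‖ < δ →
      ‖K (x + v, x + w) - K (x + v, x) - (K (x, x + w) - K (x, x)) - D₁₂ (x, x) w v‖ ≤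
        ε * ‖v‖ * ‖w‖ := by
  obtain ⟨δ₁, hδ₁, hball⟩ := Metric.isOpen_iff.1 hU x hx
  obtain ⟨δ₂, hδ₂, hc'⟩ := Metric.eventually_nhds_iff.1
    (eventually_norm_sub_lt (F := E →L[ℝ] E →L[ℝ] Q) hc hε)
  have hδ : 0 < min δ₁ δ₂ := lt_min hδ₁ hδ₂
  have hin : Metric.ball x (min δ₁ δ₂) ⊆ U :=
    (Metric.ball_subset_ball (min_le_left _ _)).trans hball
  have hbd : ∀ a ∈ Metric.ball x (min δ₁ δ₂), ∀ b ∈ Metric.ball x (min δ₁ δ₂),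
      ‖D₁₂ (a, b) - D₁₂ (x, x)‖ ≤ ε := fun a ha b hb => by
    refine (hc' ?_).le
    rw [Prod.dist_eq]
    exact max_lt (lt_of_lt_of_le ha (min_le_right _ _)) (lt_of_lt_of_le hb (min_le_right _ _))
  have hxb : x ∈ Metric.ball x (min δ₁ δ₂) := Metric.mem_ball_self hδ
  refine ⟨min δ₁ δ₂, hδ, fun v w hv hw => ?_⟩
  have hvb : x + v ∈ Metric.ball x (min δ₁ δ₂) := by simpa using hv
  have hwb : x + w ∈ Metric.ball x (min δ₁ δ₂) := by simpa using hw
  -- The mean value inequality is used twice: here in the second variable for `D₁ (a, ·)`, then in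
  -- the first variable for `a ↦ K (a, x + w) - K (a, x)`.
  have key : ∀ a ∈ Metric.ball x (min δ₁ δ₂),
      ‖D₁ (a, x + w) - D₁ (a, x) - D₁₂ (x, x) w‖ ≤ ε * ‖w‖ := fun a ha => by
    simpa using (convex_ball x (min δ₁ δ₂)).norm_image_sub_le_of_norm_hasFDerivWithin_le'
      (f := fun b => D₁ (a, b)) (φ := D₁₂ (x, x))
      (fun b hb => (h₂ a (hin ha) b (hin hb)).hasFDerivWithinAt)
      (fun b hb => hbd a ha b hb) hxb hwb
  have := (convex_ball x (min δ₁ δ₂)).norm_image_sub_le_of_norm_hasFDerivWithin_le'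
      (f := fun a => K (a, x + w) - K (a, x)) (φ := D₁₂ (x, x) w)
      (fun a ha => ((h₁ a (hin ha) _ (hin hwb)).sub (h₁ a (hin ha) x (hin hxb))).hasFDerivWithinAt)
      (fun a ha => key a ha) hxb hvb
  simpa [mul_right_comm] using this

/-- If the Gram kernel of `d` under a coercive pairing is bilinear to first order, then `d` maps
linear relations between small vectors to approximate linear relations. -/
theorem norm_sum_smul_le {β : G →L[ℝ] G →L[ℝ] Q} (hβ : ∀ g, ‖g‖ ^ 2 ≤ ‖β g g‖) {d : E → G}
    {B : E →L[ℝ] E →L[ℝ] Q}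
    (hd : ∀ ε > 0, ∃ δ > 0, ∀ v w : E, ‖v‖ < δ → ‖w‖ < δ →
      ‖β (d v) (d w) - B w v‖ ≤ ε * ‖v‖ * ‖w‖) {ε : ℝ} (hε : 0 < ε) :
    ∃ δ > 0, ∀ (n : ℕ) (c : Fin n → ℝ) (v : Fin n → E), (∀ i, ‖v i‖ < δ) → ∑ i, c i • v i = 0 →
      ‖∑ i, c i • d (v i)‖ ≤ ε * ∑ i, |c i| * ‖v i‖ := by
  obtain ⟨δ, hδ, h⟩ := hd (ε ^ 2) (by positivity)
  refine ⟨δ, hδ, fun n c v hv hs => ?_⟩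
  -- The relation annihilates the bilinear part, so `B` may be subtracted from every entry of the
  -- Gram matrix at no cost.
  have h0 : ∑ i, ∑ j, (c i * c j) • B (v j) (v i) = 0 := by
    have : B (∑ j, c j • v j) (∑ i, c i • v i) = 0 := by simp [hs]
    rw [← this]
    simp only [map_sum, sum_apply, map_smul,
      smul_apply, smul_smul, Finset.smul_sum]
  have hexp : β (∑ i, c i • d (v i)) (∑ j, c j • d (v j)) =
      ∑ i, ∑ j, (c i * c j) • (β (d (v i)) (d (v j)) - B (v j) (v i)) := by
    simp only [smul_sub, Finset.sum_sub_distrib, h0, sub_zero]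
    simp only [map_sum, sum_apply, map_smul,
      smul_apply, smul_smul, Finset.smul_sum]
    rw [Finset.sum_comm]
    simp only [mul_comm]
  have hsum : 0 ≤ ∑ i, |c i| * ‖v i‖ := Finset.sum_nonneg fun i _ => by positivity
  refine le_of_sq_le_sq ?_ (by positivity)
  refine (hβ _).trans ?_
  rw [hexp]
  calc _ ≤ ∑ i, ∑ j, (|c i| * |c j|) * (ε ^ 2 * ‖v i‖ * ‖v j‖) := by
        refine (norm_sum_le _ _).trans (Finset.sum_le_sum fun i _ => ?_)
        refine (norm_sum_le _ _).trans (Finset.sum_le_sum fun j _ => ?_)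
        rw [norm_smul, norm_mul, Real.norm_eq_abs, Real.norm_eq_abs]
        exact mul_le_mul_of_nonneg_left (h _ _ (hv i) (hv j)) (by positivity)
    _ = _ := by
        rw [mul_pow, sq (∑ i, |c i| * ‖v i‖), Finset.sum_mul_sum, Finset.mul_sum]
        refine Finset.sum_congr rfl fun i _ => ?_
        rw [Finset.mul_sum]
        exact Finset.sum_congr rfl fun j _ => by ring

/-- A map whose Gram kernel under a coercive pairing is bilinear to first order at `0` is
differentiable at `0`. -/
theorem exists_hasFDerivAt_zero [CompleteSpace G] {β : G →L[ℝ] G →L[ℝ] Q}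
    (hβ : ∀ g, ‖g‖ ^ 2 ≤ ‖β g g‖) {d : E → G} {B : E →L[ℝ] E →L[ℝ] Q}
    (hd : ∀ ε > 0, ∃ δ > 0, ∀ v w : E, ‖v‖ < δ → ‖w‖ < δ →
      ‖β (d v) (d w) - B w v‖ ≤ ε * ‖v‖ * ‖w‖) :
    ∃ L : E →L[ℝ] G, HasFDerivAt d L 0 := by
  have hrel := fun {ε : ℝ} (hε : 0 < ε) => norm_sum_smul_le hβ hd hε
  -- First-order bilinearity with error constant `1` bounds the Gram kernel on the diagonal by `(‖B‖
  -- + 1) ‖v‖²`; coercivity takes the square root.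
  have hbdd : ∃ δ > 0, ∀ v, ‖v‖ < δ → ‖d v‖ ≤ √(‖B‖ + 1) * ‖v‖ := by
    obtain ⟨δ, hδ, h⟩ := hd 1 one_pos
    refine ⟨δ, hδ, fun v hv => le_of_sq_le_sq ?_ (by positivity)⟩
    rw [mul_pow, Real.sq_sqrt (by positivity)]
    have h1 := h v v hv hv
    have h2 := B.le_opNorm₂ v v
    have h3 := norm_le_norm_sub_add (β (d v) (d v)) (B v v)
    nlinarith [hβ (d v)]
  have hsmall : ∀ (v : E) {δ : ℝ}, 0 < δ → ∀ᶠ t : ℝ in 𝓝[>] 0, 0 < t ∧ ‖t • v‖ < δ := by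
    intro v δ hδ
    have : Tendsto (fun t : ℝ => ‖t • v‖) (𝓝 0) (𝓝 0) := by
      have : Continuous fun t : ℝ => ‖t • v‖ := by fun_prop
      simpa using this.tendsto 0
    exact (eventually_mem_nhdsWithin).and ((this.eventually_lt_const hδ).filter_mono inf_le_left)
  have hlim : ∀ v, ∃ g, Tendsto (fun t : ℝ => t⁻¹ • d (t • v)) (𝓝[>] 0) (𝓝 g) := by
    intro v
    refine cauchy_map_iff_exists_tendsto.1 (Metric.cauchy_iff.2 ⟨inferInstance, fun ε hε => ?_⟩)
    -- The relation `s⁻¹ (s v) - t⁻¹ (t v) = 0` has total weight `2 ‖v‖` whatever `s` and `t` are,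
    -- so the quotients are Cauchy; the `+ 1` covers `v = 0`.
    obtain ⟨δ, hδ, h⟩ := hrel (ε := ε / (2 * ‖v‖ + 1)) (by positivity)
    refine ⟨_, image_mem_map (hsmall v hδ), ?_⟩
    rintro _ ⟨s, ⟨hs, hs'⟩, rfl⟩ _ ⟨t, ⟨ht, ht'⟩, rfl⟩
    have := h 2 ![s⁻¹, -t⁻¹] ![s • v, t • v]
      (by simp [Fin.forall_fin_two, hs', ht'])
      (by simp [smul_smul, hs.ne', ht.ne'])
    simp only [Fin.sum_univ_two, Matrix.cons_val_zero, Matrix.cons_val_one, norm_smul,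
      Real.norm_eq_abs, abs_neg, abs_inv, neg_smul, ← sub_eq_add_neg] at this
    rw [inv_mul_cancel_left₀ (abs_pos.2 hs.ne').ne', inv_mul_cancel_left₀ (abs_pos.2 ht.ne').ne',
      ← two_mul] at this
    rw [dist_eq_norm]
    refine this.trans_lt ?_
    rw [div_mul_eq_mul_div, div_lt_iff₀ (by positivity)]
    nlinarith
  choose ℓ hℓ using hlim
  have hzero : ∀ {f : ℝ → G} {g : G}, Tendsto f (𝓝[>] 0) (𝓝 g) →
      (∃ C : ℝ, 0 ≤ C ∧ ∀ ε > 0, ∀ᶠ t in 𝓝[>] 0, ‖f t‖ ≤ ε * C) → g = 0 := by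
    rintro f g hf ⟨C, hC, h⟩
    refine tendsto_nhds_unique hf (tendsto_zero_iff_norm_tendsto_zero.2 ?_)
    refine tendsto_order.2 ⟨fun a ha => Eventually.of_forall fun t => ha.trans_le (norm_nonneg _),
      fun a ha => ?_⟩
    filter_upwards [h (a / (C + 1)) (by positivity)] with t ht
    refine ht.trans_lt ?_
    rw [div_mul_eq_mul_div, div_lt_iff₀ (by positivity)]
    nlinarith
  have hadd : ∀ v w, ℓ (v + w) = ℓ v + ℓ w := by
    intro v w
    rw [← sub_eq_zero]
    refine hzero ((hℓ (v + w)).sub ((hℓ v).add (hℓ w)))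
      ⟨‖v + w‖ + ‖v‖ + ‖w‖, by positivity, fun ε hε => ?_⟩
    obtain ⟨δ, hδ, h⟩ := hrel hε
    filter_upwards [hsmall (v + w) hδ, hsmall v hδ, hsmall w hδ] with t ⟨ht, h1⟩ ⟨_, h2⟩ ⟨_, h3⟩
    have := h 3 ![t⁻¹, -t⁻¹, -t⁻¹] ![t • (v + w), t • v, t • w]
      (by simp only [Fin.forall_fin_succ]; exact ⟨h1, h2, h3, fun i => i.elim0⟩)
      (by simp [Fin.sum_univ_three, smul_smul, ht.ne'])
    simp only [Fin.sum_univ_three, Matrix.cons_val, norm_smul,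
      Real.norm_eq_abs, abs_neg, abs_inv, neg_smul] at this
    simp only [inv_mul_cancel_left₀ (abs_pos.2 ht.ne').ne'] at this
    convert this using 2
    abel
  have hsmul : ∀ (c : ℝ) v, ℓ (c • v) = c • ℓ v := by
    intro c v
    rw [← sub_eq_zero]
    refine hzero ((hℓ (c • v)).sub ((hℓ v).const_smul c))
      ⟨‖c • v‖ + |c| * ‖v‖, by positivity, fun ε hε => ?_⟩
    obtain ⟨δ, hδ, h⟩ := hrel hε
    filter_upwards [hsmall (c • v) hδ, hsmall v hδ] with t ⟨ht, h1⟩ ⟨_, h2⟩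
    have := h 2 ![t⁻¹, -(c * t⁻¹)] ![t • c • v, t • v]
      (by simp only [Fin.forall_fin_two]; exact ⟨h1, h2⟩)
      (by simp [smul_smul, ht.ne'])
    simp only [Fin.sum_univ_two, Matrix.cons_val_zero, Matrix.cons_val_one, norm_smul t,
      Real.norm_eq_abs, abs_neg, abs_inv, neg_smul, abs_mul, mul_assoc, ← sub_eq_add_neg] at this
    simp only [inv_mul_cancel_left₀ (abs_pos.2 ht.ne').ne'] at this
    simpa only [smul_smul] using this
  have hnorm : ∀ v, ‖ℓ v‖ ≤ √(‖B‖ + 1) * ‖v‖ := by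
    intro v
    obtain ⟨δ, hδ, h⟩ := hbdd
    refine le_of_tendsto (hℓ v).norm ?_
    filter_upwards [hsmall v hδ] with t ⟨ht, h1⟩
    rw [norm_smul, norm_inv, inv_mul_le_iff₀ (norm_pos_iff.2 ht.ne')]
    refine (h _ h1).trans_eq ?_
    rw [norm_smul]
    ring
  refine ⟨LinearMap.mkContinuous ⟨⟨ℓ, hadd⟩, hsmul⟩ _ hnorm, ?_⟩
  have hd0 : d 0 = 0 := by
    obtain ⟨δ, hδ, h⟩ := hbdd
    simpa using h 0 (by simpa using hδ)
  rw [hasFDerivAt_iff_isLittleO_nhds_zero, Asymptotics.isLittleO_iff]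
  intro ε hε
  -- The relation `v - t⁻¹ (t v) = 0` has weight `2 ‖v‖`, whence `ε / 2`. The estimate is uniform in
  -- small `t`, and `t → 0` replaces the quotient by `ℓ v`.
  obtain ⟨δ, hδ, h⟩ := hrel (ε := ε / 2) (by positivity)
  filter_upwards [Metric.ball_mem_nhds (0 : E) hδ] with v hv
  have hv : ‖v‖ < δ := by simpa using hv
  simp only [zero_add, hd0, sub_zero]
  refine le_of_tendsto ((tendsto_const_nhds.sub (hℓ v)).norm) ?_
  filter_upwards [hsmall v hδ] with t ⟨ht, h1⟩
  have := h 2 ![1, -t⁻¹] ![v, t • v]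
    (by simp [Fin.forall_fin_two, hv, h1])
    (by simp [smul_smul, ht.ne'])
  simp only [Fin.sum_univ_two, Matrix.cons_val_zero, Matrix.cons_val_one, norm_smul t,
    Real.norm_eq_abs, abs_neg, abs_inv, neg_smul, abs_one, one_mul, one_smul,
    ← sub_eq_add_neg, inv_mul_cancel_left₀ (abs_pos.2 ht.ne').ne'] at this
  linarith

/-- The pairing `(a, b) ↦ (w ↦ v ↦ β (a v) (b w))` of operators induced by a pairing `β`. -/
def operatorPairing (E : Type*) [NormedAddCommGroup E] [NormedSpace ℝ E] (β : G →L[ℝ] G →L[ℝ] Q) :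
    (E →L[ℝ] G) →L[ℝ] (E →L[ℝ] G) →L[ℝ] E →L[ℝ] E →L[ℝ] Q :=
  (ContinuousLinearMap.compL ℝ E G (E →L[ℝ] Q)).comp
    (((ContinuousLinearMap.compL ℝ G (G →L[ℝ] Q) (E →L[ℝ] Q)).flip β.flip).comp
      (ContinuousLinearMap.compL ℝ E G Q).flip)

/-- Coercivity survives passage to operators because `‖a v‖² ≤ ‖β (a v) (a v)‖`, and the right side
is the induced pairing of `a` with itself evaluated at `v, v`. This lets the differentiability
argument be iterated. -/
theorem operatorPairing_coercive {β : G →L[ℝ] G →L[ℝ] Q} (hβ : ∀ g, ‖g‖ ^ 2 ≤ ‖β g g‖)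
    (a : E →L[ℝ] G) : ‖a‖ ^ 2 ≤ ‖operatorPairing E β a a‖ := by
  have h : ‖a‖ ≤ √‖operatorPairing E β a a‖ := by
    refine a.opNorm_le_bound (Real.sqrt_nonneg _) fun v => ?_
    refine le_of_sq_le_sq ?_ (by positivity)
    rw [mul_pow, Real.sq_sqrt (norm_nonneg (operatorPairing E β a a)), sq ‖v‖, ← mul_assoc]
    exact (hβ (a v)).trans ((operatorPairing E β a a).le_opNorm₂ v v)
  calc ‖a‖ ^ 2 ≤ √‖operatorPairing E β a a‖ ^ 2 := by gcongr
    _ = _ := Real.sq_sqrt (norm_nonneg (operatorPairing E β a a))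

/-- A map whose Gram kernel under a coercive pairing is smooth is differentiable. -/
theorem differentiableAt_of_gram [CompleteSpace G] {β : G →L[ℝ] G →L[ℝ] Q}
    (hβ : ∀ g, ‖g‖ ^ 2 ≤ ‖β g g‖) {φ : E → G} {U : Set E} (hU : IsOpen U)
    (hK : ContDiffOn ℝ ∞ (fun p : E × E => β (φ p.1) (φ p.2)) (U ×ˢ U)) :
    DifferentiableOn ℝ φ U ∧
      ContDiffOn ℝ ∞ (fun p : E × E => operatorPairing E β (fderiv ℝ φ p.1) (fderiv ℝ φ p.2))
        (U ×ˢ U) := by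
  set K : E × E → Q := fun p => β (φ p.1) (φ p.2) with hKdef
  have hUU : IsOpen (U ×ˢ U) := hU.prod hU
  set D₁ : E × E → E →L[ℝ] Q := fun p => (fderiv ℝ K p).comp (.inl ℝ E E)
  set D₁₂ : E × E → E →L[ℝ] E →L[ℝ] Q := fun p => (fderiv ℝ D₁ p).comp (.inr ℝ E E)
  have hD₁ : ContDiffOn ℝ ∞ D₁ (U ×ˢ U) :=
    (hK.fderiv_of_isOpen (m := ∞) hUU le_rfl).clm_comp contDiffOn_const
  have hD₁₂ : ContDiffOn ℝ ∞ D₁₂ (U ×ˢ U) :=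
    (hD₁.fderiv_of_isOpen (m := ∞) hUU le_rfl).clm_comp contDiffOn_const
  have h₁ : ∀ a ∈ U, ∀ b ∈ U, HasFDerivAt (fun v => K (v, b)) (D₁ (a, b)) a := by
    intro a ha b hb
    have h : HasFDerivAt K (fderiv ℝ K (a, b)) (a, b) :=
      ((hK.contDiffAt (hUU.mem_nhds (Set.mk_mem_prod ha hb))).differentiableAt
        (by simp)).hasFDerivAt
    exact HasFDerivAt.comp (f := fun v => (v, b)) a h (hasFDerivAt_prodMk_left a b)
  have h₂ : ∀ a ∈ U, ∀ b ∈ U, HasFDerivAt (fun w => D₁ (a, w)) (D₁₂ (a, b)) b := by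
    intro a ha b hb
    have h : HasFDerivAt D₁ (fderiv ℝ D₁ (a, b)) (a, b) :=
      ((hD₁.contDiffAt (hUU.mem_nhds (Set.mk_mem_prod ha hb))).differentiableAt
        (by simp)).hasFDerivAt
    exact HasFDerivAt.comp (f := fun w => (a, w)) b h (hasFDerivAt_prodMk_right a b)
  have hφ : ∀ x ∈ U, DifferentiableAt ℝ φ x := by
    intro x hx
    -- The Gram kernel of the increments `φ (x + v) - φ x` is exactly the second difference of `K`
    -- at `(x, x)`.
    obtain ⟨L, hL⟩ := exists_hasFDerivAt_zero hβ (d := fun v => φ (x + v) - φ x)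
      (B := D₁₂ (x, x)) (fun ε hε => by
        obtain ⟨δ, hδ, h⟩ := norm_second_difference_sub_le hU h₁ h₂ hx
          ((hD₁₂.contDiffAt (hUU.mem_nhds (Set.mk_mem_prod hx hx))).continuousAt) hε
        refine ⟨δ, hδ, fun v w hv hw => ?_⟩
        convert h v w hv hw using 3
        simp only [hKdef, map_sub, sub_apply]
        abel)
    have hL' : HasFDerivAt (fun v => φ (x + v)) L 0 := by simpa using hL.add_const (φ x)
    have hs : HasFDerivAt (fun y : E => y - x) (ContinuousLinearMap.id ℝ E) x :=
      (hasFDerivAt_id x).sub_const x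
    have hL'' : HasFDerivAt (fun v => φ (x + v)) L (x - x) := by simpa using hL'
    have := HasFDerivAt.comp (f := fun y => y - x) x hL'' hs
    simp only [Function.comp_def, add_sub_cancel] at this
    exact this.differentiableAt
  refine ⟨fun x hx => (hφ x hx).differentiableWithinAt, hD₁₂.congr ?_⟩
  rintro ⟨a, b⟩ ⟨ha, hb⟩
  -- The mixed derivative is identified one variable at a time: `D₁ (a, y)` is `v ↦ β (φ' a v) (φ
  -- y)`, and differentiating it in `y` gives the operator pairing of `φ' a` and `φ' b`.
  have e₁ : ∀ y ∈ U, D₁ (a, y) = (β.flip (φ y)).comp (fderiv ℝ φ a) := fun y hy =>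
    (h₁ a ha y hy).unique ((β.flip (φ y)).hasFDerivAt.comp a (hφ a ha).hasFDerivAt)
  have e₂ : HasFDerivAt (fun y => (β.flip (φ y)).comp (fderiv ℝ φ a))
      ((((ContinuousLinearMap.compL ℝ E G Q).flip (fderiv ℝ φ a)).comp β.flip).comp
        (fderiv ℝ φ b)) b :=
    (((ContinuousLinearMap.compL ℝ E G Q).flip (fderiv ℝ φ a)).comp β.flip).hasFDerivAt.comp b
      (hφ b hb).hasFDerivAt
  have e₃ := (h₂ a ha b hb).congr_of_eventuallyEq
    (Filter.eventuallyEq_of_mem (hU.mem_nhds hb) fun y hy => (e₁ y hy).symm)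
  exact e₂.unique e₃

end Gram

/-- A map into a Banach space whose Gram kernel under a coercive pairing is smooth is `C^n`. -/
theorem contDiffOn_nat_of_gram.{u, v, w} {E : Type u} [NormedAddCommGroup E] [NormedSpace ℝ E]
    {U : Set E} (hU : IsOpen U) (n : ℕ) :
    ∀ {G : Type (max u v)} {Q : Type (max u w)} [NormedAddCommGroup G] [NormedSpace ℝ G] [CompleteSpace G]
      [NormedAddCommGroup Q] [NormedSpace ℝ Q] {β : G →L[ℝ] G →L[ℝ] Q}
      (_ : ∀ g, ‖g‖ ^ 2 ≤ ‖β g g‖) {φ : E → G}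
      (_ : ContDiffOn ℝ ∞ (fun p : E × E => β (φ p.1) (φ p.2)) (U ×ˢ U)),
      ContDiffOn ℝ n φ U := by
  induction n with
  | zero =>
    intro G Q _ _ _ _ _ β hβ φ hK
    exact contDiffOn_zero.2 (differentiableAt_of_gram hβ hU hK).1.continuousOn
  | succ n ih =>
    intro G Q _ _ _ _ _ β hβ φ hK
    obtain ⟨h1, h2⟩ := differentiableAt_of_gram hβ hU hK
    rw [Nat.cast_succ, contDiffOn_succ_iff_fderiv_of_isOpen hU]
    exact ⟨h1, by simp, ih (G := E →L[ℝ] G) (Q := E →L[ℝ] E →L[ℝ] Q)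
      (operatorPairing_coercive hβ) h2⟩

/-- A map into a Banach space whose Gram kernel under a coercive pairing is smooth is smooth. -/
theorem contDiffOn_of_gram.{u, v, w} {E : Type u} {G : Type v} {Q : Type w}
    [NormedAddCommGroup E] [NormedSpace ℝ E]
    [NormedAddCommGroup G] [NormedSpace ℝ G] [CompleteSpace G]
    [NormedAddCommGroup Q] [NormedSpace ℝ Q] {β : G →L[ℝ] G →L[ℝ] Q}
    (hβ : ∀ g, ‖g‖ ^ 2 ≤ ‖β g g‖) {φ : E → G} {U : Set E} (hU : IsOpen U)
    (hK : ContDiffOn ℝ ∞ (fun p : E × E => β (φ p.1) (φ p.2)) (U ×ˢ U)) :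
    ContDiffOn ℝ ∞ φ U := by
  obtain ⟨h1, h2⟩ := differentiableAt_of_gram hβ hU hK
  -- The first derivative is split off because the induction changes the target from `G` to `E →L[ℝ]
  -- G`, and so needs universes already closed under this operation; `E →L[ℝ] G` lies in such a
  -- universe even when `G` does not.
  have h3 : ContDiffOn ℝ ∞ (fderiv ℝ φ) U := contDiffOn_infty.2 fun n =>
    contDiffOn_nat_of_gram.{u, v, w} hU n (G := E →L[ℝ] G) (Q := E →L[ℝ] E →L[ℝ] Q)
      (operatorPairing_coercive hβ) h2
  exact (contDiffOn_infty_iff_fderiv_of_isOpen hU).2 ⟨h1, h3⟩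

/-! ### Tangent vectors to the tautological bundle -/

section TautologicalTangent

variable {H : Type*} [NormedAddCommGroup H] [InnerProductSpace ℂ H] [CompleteSpace H]

theorem proj_mul_self (S : ClosedSubmodule ℂ H) : proj S * proj S = proj S :=
  S.toSubmodule.isIdempotentElem_starProjection

theorem star_proj (S : ClosedSubmodule ℂ H) : star (proj S) = proj S :=
  isSelfAdjoint_starProjection S.toSubmodule

theorem move_one (τ : Taut H) : Taut.move 1 τ = τ := by
  refine Taut.ext ?_ rfl
  ext h
  rw [Taut.move]
  change (∃ y ∈ τ.base, (1 : H →L[ℂ] H) y = h) ↔ _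
  simp

/-- A pair `(P', h')` satisfying the linearized equations of the tautological bundle is a tangent
vector, and the universal connection sends it to `(0, p_S h')`. -/
theorem universalConnection_of_linearized (τ : Taut H) {P' : H →L[ℂ] H} {h' : H}
    (hs : star P' = P') (hP : P' * proj τ.base + proj τ.base * P' = P')
    (hh : P' τ.vec + proj τ.base h' = h') :
    UniversalConnection (τ, (P', h')) (τ, (0, proj τ.base h')) := by
  obtain ⟨S, x, hx⟩ := τ
  dsimp only at hP hh ⊢
  set P := proj S with hPdef
  have hPP : P * P = P := proj_mul_self S
  have hPs : star P = P := star_proj S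
  have hPx : P x = x := proj_apply_coe S ⟨x, hx⟩
  have hmem : ∀ h, P h ∈ S := fun h => Submodule.starProjection_apply_mem S.toSubmodule h
  -- Compressing `P' P + P P' = P'` by `P` on both sides gives `2 P P' P = P P' P`.
  have hPPP : P * P' * P = 0 := by
    have h := congrArg (fun T => P * T * P) hP
    simp only [mul_add, add_mul] at h
    rw [show P * (P' * P) * P = P * P' * (P * P) by noncomm_ring, hPP,
      show P * (P * P') * P = (P * P) * P' * P by noncomm_ring, hPP] at h
    simpa using h
  have hX : P' * P - P * P' ∈ skewAdjoint (H →L[ℂ] H) := by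
    rw [skewAdjoint.mem_iff, star_sub, star_mul, star_mul, hPs, hs, neg_sub]
  have hPX : P (P' x) = 0 := by
    have h : P (P' (P x)) = 0 := congrArg (fun T : H →L[ℂ] H => T x) hPPP
    rwa [hPx] at h
  have hXx : (P' * P - P * P') x = P' x := by
    change P' (P x) - P (P' x) = P' x
    rw [hPx, hPX, sub_zero]
  -- The generator is `X = [P', P]`: it is skew-adjoint, `[X, P] = P'`, and `X x = P' x` is
  -- orthogonal to `S`. Hence `E_p(X) x = 0`, and `y` and `y'` both equal `P h'`.
  refine ⟨S, 1, ⟨_, hX⟩, ⟨x, hx⟩, ⟨P h', hmem h'⟩, ⟨P h', hmem h'⟩, ?_, ?_, ?_⟩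
  · rw [condExpectation_apply]
    change P h' = P ((P' * P - P * P') x) + P h'
    rw [hXx, hPX, zero_add]
  · rw [tangentClass_eq]
    refine Prod.ext ?_ (Prod.ext ?_ ?_)
    · exact (move_one _).symm
    · simp only [OneMemClass.coe_one, one_mul, star_one, mul_one, ← hPdef]
      rw [show (P' * P - P * P') * P - P * (P' * P - P * P') =
        P' * (P * P) + (P * P) * P' - 2 • (P * P' * P) by noncomm_ring, hPP, hPPP, hP]
      simp
    · simp only [OneMemClass.coe_one, one_apply_eq_self]
      rw [hXx, hh]
  · rw [tangentClass_eq]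
    refine Prod.ext ?_ (Prod.ext ?_ ?_)
    · exact (move_one _).symm
    · simp
    · simp

variable {B : Type*} [NormedAddCommGroup B] [NormedSpace ℝ B] {L : Type*} [TopologicalSpace L]
  {I : ModelWithCorners ℝ B L} {M : Type*} [TopologicalSpace M] [ChartedSpace L M]

/-- A map with values in a level set of `g` has derivatives in the kernel of the derivative of
`g`. -/
theorem apply_mfderiv_eq_zero_of_comp_eq_const {V W : Type*} [NormedAddCommGroup V]
    [NormedSpace ℝ V] [NormedAddCommGroup W] [NormedSpace ℝ W] {f : M → V} {p : M}
    (hf : MDifferentiableAt I 𝓘(ℝ, V) f p) {g : V → W} {g' : V →L[ℝ] W}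
    (hg : HasFDerivAt g g' (f p)) {c : W} (hc : ∀ q, g (f q) = c) (v : TangentSpace I p) :
    g' (mfderiv I 𝓘(ℝ, V) f p v) = 0 := by
  have h := hg.hasMFDerivAt.comp p hf.hasMFDerivAt
  have h' : HasMFDerivAt I 𝓘(ℝ, W) (g ∘ f) p 0 := by
    rw [show g ∘ f = fun _ => c from funext hc]
    exact hasMFDerivAt_const c p
  exact congrArg (fun T => T v) (hasMFDerivAt_unique h h')

/-- The velocities of a differentiable map into the tautological bundle are tangent vectors. -/
theorem universalConnection_mfderiv {f : M → Taut H} {p : M}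
    (hf : MDifferentiableAt I 𝓘(ℝ, (H →L[ℂ] H) × H) (fun q => (f q).emb) p)
    (v : TangentSpace I p) :
    UniversalConnection
      (f p, (mfderiv I 𝓘(ℝ, (H →L[ℂ] H) × H) (fun q => (f q).emb) p v : (H →L[ℂ] H) × H))
      (f p, (0, proj (f p).base
        (mfderiv I 𝓘(ℝ, (H →L[ℂ] H) × H) (fun q => (f q).emb) p v : (H →L[ℂ] H) × H).2)) := by
  set w : (H →L[ℂ] H) × H := mfderiv I 𝓘(ℝ, (H →L[ℂ] H) × H) (fun q => (f q).emb) p v with hw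
  have hfst : HasFDerivAt (𝕜 := ℝ) (Prod.fst : (H →L[ℂ] H) × H → _) (.fst ℝ _ _) (f p).emb :=
    hasFDerivAt_fst
  have hsnd : HasFDerivAt (𝕜 := ℝ) (Prod.snd : (H →L[ℂ] H) × H → _) (.snd ℝ _ _) (f p).emb :=
    hasFDerivAt_snd
  -- The linearized equations come from differentiating `p* = p`, `p² = p` and `p h = h`, which hold
  -- identically along the map.
  refine universalConnection_of_linearized (f p) (P' := w.1) (h' := w.2) ?_ ?_ ?_
  · have hstar : HasFDerivAt (𝕜 := ℝ) (fun a : (H →L[ℂ] H) × H => star a.1 - a.1)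
        ((((starL' ℝ : (H →L[ℂ] H) ≃L[ℝ] (H →L[ℂ] H)) : (H →L[ℂ] H) →L[ℝ] (H →L[ℂ] H)).comp
          (.fst ℝ _ _)) - .fst ℝ _ _) (f p).emb :=
      ((starL' ℝ : (H →L[ℂ] H) ≃L[ℝ] (H →L[ℂ] H)).hasFDerivAt.comp _ hfst).sub hfst
    have := apply_mfderiv_eq_zero_of_comp_eq_const hf hstar (c := 0)
      (fun q => sub_eq_zero.2 (star_proj _)) v
    exact sub_eq_zero.1 this
  · have := apply_mfderiv_eq_zero_of_comp_eq_const hf ((hfst.mul' hfst).sub hfst) (c := 0)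
      (fun q => sub_eq_zero.2 (proj_mul_self _)) v
    have h := sub_eq_zero.1 this
    rw [add_comm]
    exact h
  · have hap : HasFDerivAt (𝕜 := ℝ) (fun a : (H →L[ℂ] H) × H => a.1 a.2 - a.2) _ (f p).emb :=
      ((((ContinuousLinearMap.restrictScalarsL ℂ H H ℝ ℝ).hasFDerivAt.comp
        (f p).emb hfst)).clm_apply hsnd).sub hsnd
    have := apply_mfderiv_eq_zero_of_comp_eq_const hf hap (c := 0)
      (fun q => sub_eq_zero.2 (proj_apply_coe _ ⟨_, (f q).mem⟩)) v
    have h := sub_eq_zero.1 this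
    rw [add_comm]
    exact h

end TautologicalTangent

/-! ### Smoothness of the classifying map -/

section ClassifyingMap

variable {E : Type*} [NormedAddCommGroup E] [NormedSpace ℝ E]
  {X : Type*} [TopologicalSpace X] [ChartedSpace E X]
  {H : Type*} [NormedAddCommGroup H] [InnerProductSpace ℂ H] [CompleteSpace H] [RKHS ℂ H X ℂ]

variable (H) in
/-- The kernel function `κ_x`. -/
def kernelVector {X : Type*} [RKHS ℂ H X ℂ] (x : X) : H := RKHS.kerFun H x 1

theorem kerFun_eq_smul {X : Type*} [RKHS ℂ H X ℂ] (x : X) (z : ℂ) :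
    RKHS.kerFun H x z = z • kernelVector H x := by
  rw [kernelVector, ← map_smul, smul_eq_mul, mul_one]

theorem IsKernelOf.inner_kernelVector {X : Type*} [RKHS ℂ H X ℂ] {κ : X → X → ℂ}
    (hκ : IsKernelOf κ H) (x y : X) :
    inner ℂ (kernelVector H x) (kernelVector H y) = κ x y := by
  rw [kernelVector, RKHS.kerFun_inner, kernelVector, RKHS.kerFun_apply, hκ]
  simp

theorem IsKernelOf.kernelVector_ne_zero {X : Type*} [RKHS ℂ H X ℂ] {κ : X → X → ℂ}
    (hκ : IsKernelOf κ H) {x : X} (h0 : κ x x ≠ 0) : kernelVector H x ≠ 0 := fun h => by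
  rw [← hκ.inner_kernelVector, h, inner_zero_left] at h0
  exact h0 rfl

theorem toSubmodule_lineMap {X : Type*} [RKHS ℂ H X ℂ] (x : X) :
    (lineMap H x).toSubmodule = ℂ ∙ kernelVector H x := by
  have h : (RKHS.kerFun H x : ℂ →L[ℂ] H).range = ℂ ∙ kernelVector H x := by
    ext h
    simp [Submodule.mem_span_singleton, kerFun_eq_smul]
  change ((RKHS.kerFun H x : ℂ →L[ℂ] H).range).topologicalClosure = _
  rw [h]
  -- The range is at most one-dimensional, hence closed, so the closure in `lineMap` adds nothing.
  exact (Submodule.closed_of_finiteDimensional _).submodule_topologicalClosure_eq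

theorem proj_lineMap_apply {X : Type*} [RKHS ℂ H X ℂ] (x : X) (h : H) :
    proj (lineMap H x) h =
      (inner ℂ (kernelVector H x) h / inner ℂ (kernelVector H x) (kernelVector H x)) •
        kernelVector H x := by
  have : proj (lineMap H x) h = (ℂ ∙ kernelVector H x).starProjection h := by
    unfold proj
    congr 2
    exact toSubmodule_lineMap x
  rw [this, Submodule.starProjection_singleton, inner_self_eq_norm_sq_to_K]
  norm_cast

theorem proj_lineMap {X : Type*} [RKHS ℂ H X ℂ] (x : X) :
    proj (lineMap H x) = (inner ℂ (kernelVector H x) (kernelVector H x))⁻¹ •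
      InnerProductSpace.rankOne ℂ (kernelVector H x) (kernelVector H x) := by
  ext h
  rw [proj_lineMap_apply, div_eq_inv_mul, mul_smul]
  rfl

/-- The scalars must be real: the rank-one operator is conjugate-linear in its second vector. -/
theorem isBoundedBilinearMap_rankOne :
    IsBoundedBilinearMap ℝ (fun p : H × H => InnerProductSpace.rankOne ℂ p.1 p.2) where
  add_left _ _ _ := by simp
  smul_left _ _ _ := by ext; simp
  add_right _ _ _ := by simp
  smul_right c x y := by 
    ext h
    simp only [InnerProductSpace.rankOne_apply, smul_apply, inner_smul_left_eq_star_smul,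
      smul_assoc, starRingEnd_apply, star_trivial]
  bound := ⟨1, one_pos, fun x y => by simp⟩

/-- The kernel functions of a smooth kernel depend smoothly on the point. -/
theorem IsSmoothKernel.contMDiff_kernelVector [IsManifold 𝓘(ℝ, E) ∞ X] {κ : X → X → ℂ}
    (hs : IsSmoothKernel E κ) (hκ : IsKernelOf κ H) :
    ContMDiff 𝓘(ℝ, E) 𝓘(ℝ, H) ∞ (kernelVector H : X → H) := by
  intro x
  set e := extChartAt 𝓘(ℝ, E) x with he
  have htarget : IsOpen e.target := isOpen_extChartAt_target x
  have hsymm : ContMDiffOn 𝓘(ℝ, E) 𝓘(ℝ, E) ∞ e.symm e.target := contMDiffOn_extChartAt_symm x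
  have hφ : ContDiffOn ℝ ∞ (fun a => kernelVector H (e.symm a)) e.target := by
    -- The complex inner product serves as a real bilinear pairing, coercive because `‖⟨g, g⟩‖ =
    -- ‖g‖²`. In the chart its Gram kernel is `κ`.
    refine contDiffOn_of_gram (β := (isBoundedBilinearMap_inner (𝕜 := ℂ) (E := H)
      ).toContinuousLinearMap) (fun g => ?_) htarget ?_
    · simp [IsBoundedBilinearMap.toContinuousLinearMap_apply]
    · have : ContMDiffOn 𝓘(ℝ, E × E) 𝓘(ℝ, ℂ) ∞
          (fun p : E × E => κ (e.symm p.1) (e.symm p.2)) (e.target ×ˢ e.target) := by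
        rw [modelWithCornersSelf_prod, ← chartedSpaceSelf_prod]
        exact hs.comp_contMDiffOn (hsymm.prodMap hsymm)
      refine this.contDiffOn.congr fun p _ => ?_
      exact hκ.inner_kernelVector _ _
  have h := (hφ.contMDiffOn.comp (contMDiffOn_extChartAt (I := 𝓘(ℝ, E)) (n := ∞) (x := x))
    (fun y hy => e.map_source (by simpa [he] using hy))).contMDiffAt
      ((chartAt E x).open_source.mem_nhds (mem_chart_source E x))
  refine h.congr_of_eventuallyEq ?_
  filter_upwards [extChartAt_source_mem_nhds (I := 𝓘(ℝ, E)) x] with y hy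
  exact congrArg (kernelVector H) (e.left_inv hy).symm

theorem contMDiff_proj_lineMap (hk : ContMDiff 𝓘(ℝ, E) 𝓘(ℝ, H) ∞ (kernelVector H : X → H))
    (h0 : ∀ x : X, kernelVector H x ≠ 0) :
    ContMDiff 𝓘(ℝ, E) 𝓘(ℝ, H →L[ℂ] H) ∞ (fun x : X => proj (lineMap H x)) := by
  have hin : ContDiff ℝ ∞ (fun h : H => inner ℂ h h) := contDiff_id.inner ℂ contDiff_id
  have hrk : ContDiff ℝ ∞ (fun h : H => InnerProductSpace.rankOne ℂ h h) :=
    (isBoundedBilinearMap_rankOne (H := H)).contDiff.comp (contDiff_id.prodMk contDiff_id)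
  intro x
  have h : ContDiffAt ℝ ∞ (fun h : H => (inner ℂ h h)⁻¹ • InnerProductSpace.rankOne ℂ h h)
      (kernelVector H x) :=
    (hin.contDiffAt.inv (inner_self_ne_zero.2 (h0 x))).smul hrk.contDiffAt
  refine (h.contMDiffAt.comp x (hk x)).congr_of_eventuallyEq (Filter.Eventually.of_forall ?_)
  exact proj_lineMap

theorem contMDiff_emb_classifyingMap
    (hk : ContMDiff 𝓘(ℝ, E) 𝓘(ℝ, H) ∞ (kernelVector H : X → H))
    (h0 : ∀ x : X, kernelVector H x ≠ 0) :
    ContMDiff (𝓘(ℝ, E).prod 𝓘(ℝ, ℂ)) 𝓘(ℝ, (H →L[ℂ] H) × H) ∞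
      (fun p : X × ℂ => (classifyingMap H p).emb) := by
  have h1 := (contMDiff_proj_lineMap hk h0).comp
    (contMDiff_fst (I := 𝓘(ℝ, E)) (J := 𝓘(ℝ, ℂ)) (M := X) (N := ℂ))
  have h2 : ContMDiff (𝓘(ℝ, E).prod 𝓘(ℝ, ℂ)) 𝓘(ℝ, H) ∞ (fun p : X × ℂ => kernelMap H p) := by
    have : ContMDiff (𝓘(ℝ, E).prod 𝓘(ℝ, ℂ)) 𝓘(ℝ, H) ∞
        (fun p : X × ℂ => p.2 • kernelVector H p.1) :=
      (ContDiff.smul (𝕜 := ℝ) (n := ∞) (contDiff_fst (E := ℂ) (F := H))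
        contDiff_snd).contMDiff.comp
        (contMDiff_snd.prodMk_space (hk.comp contMDiff_fst))
    simpa only [kernelMap, kerFun_eq_smul] using this
  exact h1.prodMk_space h2

theorem bijOn_kerFun {X : Type*} [RKHS ℂ H X ℂ] {x : X} (h0 : kernelVector H x ≠ 0) :
    Set.BijOn (RKHS.kerFun H x : ℂ →L[ℂ] H) Set.univ (lineMap H x : Set H) := by
  have hmem : ∀ h : H, h ∈ lineMap H x ↔ ∃ z : ℂ, z • kernelVector H x = h := fun h => by
    rw [← Submodule.mem_span_singleton, ← toSubmodule_lineMap]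
    rfl
  refine ⟨fun z _ => (hmem _).2 ⟨z, (kerFun_eq_smul x z).symm⟩, fun z _ w _ h => ?_, fun h hh => ?_⟩
  · rw [kerFun_eq_smul, kerFun_eq_smul] at h
    exact smul_left_injective ℂ h0 h
  · obtain ⟨z, hz⟩ := (hmem h).1 hh
    exact ⟨z, trivial, (kerFun_eq_smul x z).trans hz⟩

end ClassifyingMap

/-! ### The connection induced by a smooth kernel -/

/-- The model on the target is that of the normed space `V × W`, not a product of two models; this
is the form needed for maps into `B(H) × H`. -/
theorem hasMFDerivAt_prodMk_space {B : Type*} [NormedAddCommGroup B] [NormedSpace ℝ B]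
    {L : Type*} [TopologicalSpace L] {I : ModelWithCorners ℝ B L} {M : Type*} [TopologicalSpace M]
    [ChartedSpace L M] {V W : Type*} [NormedAddCommGroup V] [NormedSpace ℝ V]
    [NormedAddCommGroup W] [NormedSpace ℝ W] {f : M → V} {g : M → W} {p : M}
    {f' : TangentSpace I p →L[ℝ] V} {g' : TangentSpace I p →L[ℝ] W}
    (hf : HasMFDerivAt I 𝓘(ℝ, V) f p f') (hg : HasMFDerivAt I 𝓘(ℝ, W) g p g') :
    HasMFDerivAt I 𝓘(ℝ, V × W) (fun q => (f q, g q)) p (f'.prod g') :=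
  ⟨hf.1.prodMk hg.1, hf.2.prodMk hg.2⟩

section InducedConnection

variable {E : Type*} [NormedAddCommGroup E] [NormedSpace ℝ E]
  {X : Type*} [TopologicalSpace X] [ChartedSpace E X]

/-! ### The kernel form and the velocity of the classifying map -/

section Form

variable {H : Type*} [NormedAddCommGroup H] [InnerProductSpace ℂ H] [CompleteSpace H]
  [RKHS ℂ H X ℂ]

variable (H) in
/-- The differential of `x ↦ κ_x`. -/
def kernelVelocity (x : X) (ξ : TangentSpace 𝓘(ℝ, E) x) : H :=
  mfderiv 𝓘(ℝ, E) 𝓘(ℝ, H) (kernelVector H : X → H) x ξ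

theorem IsKernelOf.differential_eq {κ : X → X → ℂ} (hκ : IsKernelOf κ H) {x y : X}
    (hk : MDifferentiableAt 𝓘(ℝ, E) 𝓘(ℝ, H) (kernelVector H : X → H) y)
    (ξ : TangentSpace 𝓘(ℝ, E) y) :
    differential (fun y => κ x y) y ξ = inner ℂ (kernelVector H x) (kernelVelocity H y ξ) := by
  have h1 : HasFDerivAt (𝕜 := ℝ) (fun h : H => inner ℂ (kernelVector H x) h)
      ((innerSL ℂ (kernelVector H x)).restrictScalars ℝ) (kernelVector H y) :=
    ((innerSL ℂ (kernelVector H x)).restrictScalars ℝ).hasFDerivAt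
  have h2 := h1.hasMFDerivAt.comp y hk.hasMFDerivAt
  have h3 : (fun y => κ x y) = (fun h : H => inner ℂ (kernelVector H x) h) ∘ kernelVector H :=
    funext fun y => (hκ.inner_kernelVector x y).symm
  rw [differential, h3, h2.mfderiv]
  rfl

theorem IsKernelOf.kernelForm_eq {κ : X → X → ℂ} (hκ : IsKernelOf κ H) {x : X}
    (hk : MDifferentiableAt 𝓘(ℝ, E) 𝓘(ℝ, H) (kernelVector H : X → H) x)
    (ξ : TangentSpace 𝓘(ℝ, E) x) :
    kernelForm κ x ξ = inner ℂ (kernelVector H x) (kernelVelocity H x ξ) /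
      inner ℂ (kernelVector H x) (kernelVector H x) := by
  rw [kernelForm, hκ.differential_eq hk, hκ.inner_kernelVector]

/-- The velocity of the classifying map. -/
theorem mfderiv_emb_classifyingMap
    (hk : ContMDiff 𝓘(ℝ, E) 𝓘(ℝ, H) ∞ (kernelVector H : X → H))
    (h0 : ∀ x : X, kernelVector H x ≠ 0) (p : X × ℂ) (ξ : E) (w : ℂ) :
    (mfderiv (𝓘(ℝ, E).prod 𝓘(ℝ, ℂ)) 𝓘(ℝ, (H →L[ℂ] H) × H)
        (fun p : X × ℂ => (classifyingMap H p).emb) p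
        ((ξ, w) : TangentSpace (𝓘(ℝ, E).prod 𝓘(ℝ, ℂ)) p) : (H →L[ℂ] H) × H) =
      (mfderiv 𝓘(ℝ, E) 𝓘(ℝ, H →L[ℂ] H) (fun x : X => proj (lineMap H x)) p.1 ξ,
        w • kernelVector H p.1 + p.2 • kernelVelocity H p.1 ξ) := by
  have hfst := hasMFDerivAt_fst (I := 𝓘(ℝ, E)) (I' := 𝓘(ℝ, ℂ)) p
  have hsnd := hasMFDerivAt_snd (I := 𝓘(ℝ, E)) (I' := 𝓘(ℝ, ℂ)) p
  have hkd := ((hk p.1).mdifferentiableAt (by simp)).hasMFDerivAt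
  have hP := ((contMDiff_proj_lineMap hk h0 p.1).mdifferentiableAt (by simp)).hasMFDerivAt
  have h1 := hP.comp p hfst
  have hb := ((isBoundedBilinearMap_smul (𝕜 := ℝ) (A := ℂ) (E := H)).hasFDerivAt
    (p.2, kernelVector H p.1)).hasMFDerivAt
  have h2 := HasMFDerivAt.comp (f := fun p : X × ℂ => (p.2, (kernelVector H ∘ Prod.fst) p)) p hb
    (hasMFDerivAt_prodMk_space hsnd (hkd.comp p hfst))
  have h3 : (fun p : X × ℂ => (classifyingMap H p).emb) = fun p : X × ℂ =>
      (((fun x : X => proj (lineMap H x)) ∘ Prod.fst) p,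
        ((fun a : ℂ × H => a.1 • a.2) ∘
          fun p : X × ℂ => (p.2, (kernelVector H ∘ Prod.fst) p)) p) := by
    funext q
    exact Prod.ext rfl (kerFun_eq_smul q.1 q.2)
  rw [h3, (hasMFDerivAt_prodMk_space h1 h2).mfderiv]
  refine Prod.ext rfl ?_
  exact add_comm _ _

/-- As `κ_x ≠ 0`, this shows that `Tδ` is injective on vertical vectors, which is what makes the
pull-back unique. -/
theorem mfderiv_emb_classifyingMap_vertical
    (hk : ContMDiff 𝓘(ℝ, E) 𝓘(ℝ, H) ∞ (kernelVector H : X → H))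
    (h0 : ∀ x : X, kernelVector H x ≠ 0) (p : X × ℂ) (w : ℂ) :
    (mfderiv (𝓘(ℝ, E).prod 𝓘(ℝ, ℂ)) 𝓘(ℝ, (H →L[ℂ] H) × H)
        (fun p : X × ℂ => (classifyingMap H p).emb) p
        ((0, w) : E × ℂ) : (H →L[ℂ] H) × H) = (0, w • kernelVector H p.1) := by
  refine (mfderiv_emb_classifyingMap hk h0 p 0 w).trans (Prod.ext (map_zero _) ?_)
  have h : kernelVelocity H p.1 (0 : TangentSpace 𝓘(ℝ, E) p.1) = 0 := map_zero _
  change _ + p.2 • kernelVelocity H p.1 (0 : TangentSpace 𝓘(ℝ, E) p.1) = _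
  rw [h, smul_zero, add_zero]

theorem kernelForm_smooth [IsManifold 𝓘(ℝ, E) ∞ X] {κ : X → X → ℂ} (hκ : IsKernelOf κ H)
    (hk : ContMDiff 𝓘(ℝ, E) 𝓘(ℝ, H) ∞ (kernelVector H : X → H))
    (h0 : ∀ x : X, kernelVector H x ≠ 0) :
    ContMDiff 𝓘(ℝ, E).tangent 𝓘(ℝ, ℂ) ∞
      (fun v : TangentBundle 𝓘(ℝ, E) X => kernelForm κ v.1 v.2) := by
  have ht : ContMDiff 𝓘(ℝ, E).tangent 𝓘(ℝ, H) ∞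
      (fun v : TangentBundle 𝓘(ℝ, E) X => kernelVelocity H v.1 v.2) :=
    ContMDiff.comp (g := fun u : TangentBundle 𝓘(ℝ, H) H => (u.2 : H))
      (contMDiff_snd_tangentBundle_modelSpace H 𝓘(ℝ, H))
      (hk.contMDiff_tangentMap (m := ∞) le_rfl)
  have hk' : ContMDiff 𝓘(ℝ, E).tangent 𝓘(ℝ, H) ∞
      (fun v : TangentBundle 𝓘(ℝ, E) X => kernelVector H v.1) :=
    hk.comp (Bundle.contMDiff_proj (TangentSpace 𝓘(ℝ, E)))
  have hin : ∀ a b : H, a ≠ 0 →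
      ContDiffAt ℝ ∞ (fun q : H × H => inner ℂ q.1 q.2 / inner ℂ q.1 q.1) (a, b) := by
    intro a b ha
    have h1 : ContDiff ℝ ∞ (fun q : H × H => inner ℂ q.1 q.2) := contDiff_fst.inner ℂ contDiff_snd
    have h2 : ContDiff ℝ ∞ (fun q : H × H => inner ℂ q.1 q.1) := contDiff_fst.inner ℂ contDiff_fst
    simp only [div_eq_mul_inv]
    exact h1.contDiffAt.mul (h2.contDiffAt.inv (inner_self_ne_zero.2 ha))
  intro v
  refine ((hin (kernelVector H v.1) (kernelVelocity H v.1 v.2) (h0 v.1)).contMDiffAt.comp v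
    ((hk' v).prodMk_space (ht v))).congr_of_eventuallyEq (Filter.Eventually.of_forall fun u => ?_)
  exact hκ.kernelForm_eq ((hk u.1).mdifferentiableAt (by simp)) u.2

end Form

/-- The connection `(ξ, w) ↦ (0, w + z α_x(ξ))` at `(x, z)`, where `α` is the form of `κ`. -/
def formConnection (κ : X → X → ℂ) : TangentOperators E X := fun p =>
  (ContinuousLinearMap.inr ℝ E ℂ).comp (ContinuousLinearMap.snd ℝ E ℂ +
    (ContinuousLinearMap.mul ℝ ℂ (p.2 * (κ p.1 p.1)⁻¹)).comp
      ((mfderiv 𝓘(ℝ, E) 𝓘(ℝ, ℂ) (fun y => κ p.1 y) p.1 : E →L[ℝ] ℂ).comp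
        (ContinuousLinearMap.fst ℝ E ℂ)))

theorem formConnection_apply (κ : X → X → ℂ) (p : X × ℂ) (ξ : E) (w : ℂ) :
    (formConnection (E := E) κ p ((ξ, w) : E × ℂ) : E × ℂ) =
      (0, w + p.2 * kernelForm κ p.1 (ξ : TangentSpace 𝓘(ℝ, E) p.1)) := by
  change ((0, w + (p.2 * (κ p.1 p.1)⁻¹) * differential (fun y => κ p.1 y) p.1 ξ) : E × ℂ) = _
  refine Prod.ext rfl (congrArg (w + ·) ?_)
  simp only [kernelForm, div_eq_mul_inv]
  ring

theorem kernelForm_zero (κ : X → X → ℂ) (x : X) :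
    kernelForm κ x (0 : TangentSpace 𝓘(ℝ, E) x) = 0 := by
  rw [kernelForm, differential, map_zero]
  exact zero_div _

/-- Under `T(X × ℂ) ≅ TX × Tℂ` the first component is the zero section over `x` and the second is
`(z, w + z α_x(ξ))`, so smoothness reduces to that of the form. -/
theorem contMDiff_onTangent_formConnection [IsManifold 𝓘(ℝ, E) ∞ X] {κ : X → X → ℂ}
    (hα : ContMDiff 𝓘(ℝ, E).tangent 𝓘(ℝ, ℂ) ∞
      (fun v : TangentBundle 𝓘(ℝ, E) X => kernelForm κ v.1 v.2)) :
    ContMDiff (𝓘(ℝ, E).prod 𝓘(ℝ, ℂ)).tangent (𝓘(ℝ, E).prod 𝓘(ℝ, ℂ)).tangent ∞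
      (onTangent (formConnection (E := E) κ)) := by
  have : IsManifold 𝓘(ℝ, E) 1 X := IsManifold.of_le (n := ∞) (by simp)
  have he : ContMDiff (𝓘(ℝ, E).prod 𝓘(ℝ, ℂ)).tangent (𝓘(ℝ, E).tangent.prod 𝓘(ℝ, ℂ).tangent) ∞
      (equivTangentBundleProd 𝓘(ℝ, E) X 𝓘(ℝ, ℂ) ℂ) := contMDiff_equivTangentBundleProd
  have he1 : ContMDiff (𝓘(ℝ, E).prod 𝓘(ℝ, ℂ)).tangent 𝓘(ℝ, E).tangent ∞
      (fun v => (equivTangentBundleProd 𝓘(ℝ, E) X 𝓘(ℝ, ℂ) ℂ v).1) := contMDiff_fst.comp he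
  have he2 : ContMDiff (𝓘(ℝ, E).prod 𝓘(ℝ, ℂ)).tangent 𝓘(ℝ, ℂ).tangent ∞
      (fun v => (equivTangentBundleProd 𝓘(ℝ, E) X 𝓘(ℝ, ℂ) ℂ v).2) := contMDiff_snd.comp he
  have hz : ContMDiff (𝓘(ℝ, E).prod 𝓘(ℝ, ℂ)).tangent 𝓘(ℝ, ℂ) ∞
      (fun v : TangentBundle (𝓘(ℝ, E).prod 𝓘(ℝ, ℂ)) (X × ℂ) => v.1.2) :=
    (Bundle.contMDiff_proj (TangentSpace 𝓘(ℝ, ℂ) (M := ℂ))).comp he2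
  have hw : ContMDiff (𝓘(ℝ, E).prod 𝓘(ℝ, ℂ)).tangent 𝓘(ℝ, ℂ) ∞
      (fun v : TangentBundle (𝓘(ℝ, E).prod 𝓘(ℝ, ℂ)) (X × ℂ) => (v.2.2 : ℂ)) :=
    (contMDiff_snd_tangentBundle_modelSpace ℂ 𝓘(ℝ, ℂ)).comp he2
  have ha : ContMDiff (𝓘(ℝ, E).prod 𝓘(ℝ, ℂ)).tangent 𝓘(ℝ, ℂ) ∞
      (fun v : TangentBundle (𝓘(ℝ, E).prod 𝓘(ℝ, ℂ)) (X × ℂ) =>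
        (v.2.2 : ℂ) + v.1.2 * kernelForm κ v.1.1 v.2.1) := by
    have hc : ContDiff ℝ ∞ (fun a : ℂ × ℂ × ℂ => a.1 + a.2.1 * a.2.2) := by fun_prop
    exact hc.contMDiff.comp (hw.prodMk_space (hz.prodMk_space (hα.comp he1)))
  have hx : ContMDiff (𝓘(ℝ, E).prod 𝓘(ℝ, ℂ)).tangent 𝓘(ℝ, E).tangent ∞
      (fun v : TangentBundle (𝓘(ℝ, E).prod 𝓘(ℝ, ℂ)) (X × ℂ) =>
        (⟨v.1.1, 0⟩ : TangentBundle 𝓘(ℝ, E) X)) :=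
    (Bundle.contMDiff_zeroSection ℝ (TangentSpace 𝓘(ℝ, E) (M := X))).comp
      ((Bundle.contMDiff_proj (TangentSpace 𝓘(ℝ, E) (M := X))).comp he1)
  have hy : ContMDiff (𝓘(ℝ, E).prod 𝓘(ℝ, ℂ)).tangent 𝓘(ℝ, ℂ).tangent ∞
      (fun v : TangentBundle (𝓘(ℝ, E).prod 𝓘(ℝ, ℂ)) (X × ℂ) =>
        (⟨v.1.2, (v.2.2 : ℂ) + v.1.2 * kernelForm κ v.1.1 v.2.1⟩ : TangentBundle 𝓘(ℝ, ℂ) ℂ)) := by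
    have hza := hz.prodMk ha
    rw [chartedSpaceSelf_prod] at hza
    exact ContMDiff.comp (M' := ModelProd ℂ ℂ)
      (contMDiff_tangentBundleModelSpaceHomeomorph_symm (I := 𝓘(ℝ, ℂ))) hza
  have h := (contMDiff_equivTangentBundleProd_symm (n := ∞) (I := 𝓘(ℝ, E)) (M := X)
    (I' := 𝓘(ℝ, ℂ)) (M' := ℂ)).comp (hx.prodMk hy)
  convert h using 1
  funext v
  refine congrArg (Bundle.TotalSpace.mk v.1) ?_
  exact formConnection_apply κ v.1 v.2.1 v.2.2

variable {H : Type*} [NormedAddCommGroup H] [InnerProductSpace ℂ H] [CompleteSpace H]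
  [RKHS ℂ H X ℂ]

/-- The universal connection applied to the velocity of the classifying map. -/
theorem proj_lineMap_velocity {κ : X → X → ℂ} (hκ : IsKernelOf κ H)
    (hk : ContMDiff 𝓘(ℝ, E) 𝓘(ℝ, H) ∞ (kernelVector H : X → H))
    (h0 : ∀ x : X, kernelVector H x ≠ 0) (x : X) (z : ℂ) (ξ : TangentSpace 𝓘(ℝ, E) x) (w : ℂ) :
    proj (lineMap H x) (w • kernelVector H x + z • kernelVelocity H x ξ) =
      (w + z * kernelForm κ x ξ) • kernelVector H x := by
  rw [proj_lineMap_apply, hκ.kernelForm_eq ((hk x).mdifferentiableAt (by simp)), inner_add_right,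
    inner_smul_right, inner_smul_right]
  congr 1
  have : inner ℂ (kernelVector H x) (kernelVector H x) ≠ 0 := inner_self_ne_zero.2 (h0 x)
  field_simp

variable [IsManifold 𝓘(ℝ, E) ∞ X]

/-- On vertical vectors the form vanishes and the operator is the identity, which gives idempotence
and the range. The pull-back identity is `proj_lineMap_velocity` read as `Tδ` of a vertical vector.
-/
theorem isInducedConnection_formConnection {κ : X → X → ℂ} (hκ : IsKernelOf κ H)
    (hk : ContMDiff 𝓘(ℝ, E) 𝓘(ℝ, H) ∞ (kernelVector H : X → H))
    (h0 : ∀ x : X, kernelVector H x ≠ 0) :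
    IsInducedConnection H (formConnection (E := E) κ) where
  isConnection :=
    { smooth := contMDiff_onTangent_formConnection (kernelForm_smooth hκ hk h0)
      idem := fun p v => by
        have h := formConnection_apply (E := E) κ p v.1 v.2
        change formConnection (E := E) κ p (formConnection (E := E) κ p ((v.1, v.2) : E × ℂ)) =
          formConnection (E := E) κ p ((v.1, v.2) : E × ℂ)
        rw [h]
        refine (formConnection_apply (E := E) κ p 0 _).trans (Prod.ext rfl ?_)
        change _ + p.2 * kernelForm κ p.1 (0 : TangentSpace 𝓘(ℝ, E) p.1) = _
        rw [kernelForm_zero, mul_zero, add_zero]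
      range_eq_ker := fun p => by
        rw [mfderiv_fst]
        apply le_antisymm
        · rintro _ ⟨u, rfl⟩
          exact congrArg Prod.fst (formConnection_apply (E := E) κ p u.1 u.2)
        · rintro ⟨ξ, w⟩ hv
          have hv : ξ = (0 : E) := hv
          subst hv
          refine ⟨((0, w) : E × ℂ), (formConnection_apply (E := E) κ p 0 w).trans
            (Prod.ext rfl ?_)⟩
          change w + p.2 * kernelForm κ p.1 (0 : TangentSpace 𝓘(ℝ, E) p.1) = w
          rw [kernelForm_zero, mul_zero, add_zero] }
  smooth_base := contMDiff_proj_lineMap hk h0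
  smooth_total := contMDiff_emb_classifyingMap hk h0
  fibre_bijective x := bijOn_kerFun (h0 x)
  pullback v := by
    have h := universalConnection_mfderiv (f := classifyingMap H (X := X))
      ((contMDiff_emb_classifyingMap hk h0 v.1).mdifferentiableAt (by simp)) v.2
    have h1 := mfderiv_emb_classifyingMap hk h0 v.1 v.2.1 v.2.2
    have h2 := mfderiv_emb_classifyingMap_vertical hk h0 v.1
      ((v.2.2 : ℂ) + v.1.2 * kernelForm κ v.1.1 v.2.1)
    have h3 := formConnection_apply κ v.1 v.2.1 v.2.2
    have h4 := proj_lineMap_velocity hκ hk h0 v.1.1 v.1.2 v.2.1 v.2.2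
    have h6 : tangentClassifyingMap H (onTangent (formConnection (E := E) κ) v) =
        (classifyingMap H v.1, (0, proj (classifyingMap H v.1).base
          (mfderiv (𝓘(ℝ, E).prod 𝓘(ℝ, ℂ)) 𝓘(ℝ, (H →L[ℂ] H) × H)
            (fun q : X × ℂ => (classifyingMap H q).emb) v.1 v.2 : (H →L[ℂ] H) × H).2)) := by
      refine Prod.ext rfl ?_
      refine (congrArg (mfderiv (𝓘(ℝ, E).prod 𝓘(ℝ, ℂ)) 𝓘(ℝ, (H →L[ℂ] H) × H)
        (fun p : X × ℂ => (classifyingMap H p).emb) v.1) h3).trans (h2.trans (Prod.ext rfl ?_))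
      exact h4.symm.trans
        (congrArg (fun a : (H →L[ℂ] H) × H => proj (lineMap H v.1.1) a.2) h1.symm)
    rw [h6]
    exact h

/-- The range condition makes `Φ(ξ, w) = (0, w')` vertical. Comparing vector components in the
pull-back identity gives `w' κ_x = (w + z α_x(ξ)) κ_x`, and `κ_x ≠ 0` cancels. -/
theorem IsInducedConnection.apply_eq {κ : X → X → ℂ} (hκ : IsKernelOf κ H)
    (hk : ContMDiff 𝓘(ℝ, E) 𝓘(ℝ, H) ∞ (kernelVector H : X → H))
    (h0 : ∀ x : X, kernelVector H x ≠ 0) {Φ : TangentOperators E X}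
    (hΦ : IsInducedConnection H Φ) (p : X × ℂ) (ξ : E) (w : ℂ) :
    (Φ p ((ξ, w) : E × ℂ) : E × ℂ) =
      (0, w + p.2 * kernelForm κ p.1 (ξ : TangentSpace 𝓘(ℝ, E) p.1)) := by
  have h1 : (Φ p ((ξ, w) : E × ℂ)).1 = 0 := by
    have hmem : Φ p ((ξ, w) : E × ℂ) ∈ (Φ p).range := ⟨_, rfl⟩
    rw [hΦ.isConnection.range_eq_ker p, mfderiv_fst] at hmem
    exact hmem
  refine Prod.ext h1 ?_
  set w' : ℂ := (Φ p ((ξ, w) : E × ℂ)).2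
  have h2 : (Φ p ((ξ, w) : E × ℂ) : E × ℂ) = (0, w') := Prod.ext h1 rfl
  have h3 := (hΦ.pullback ⟨p, ((ξ, w) : E × ℂ)⟩).eq
  have h4 : (mfderiv (𝓘(ℝ, E).prod 𝓘(ℝ, ℂ)) 𝓘(ℝ, (H →L[ℂ] H) × H)
      (fun p : X × ℂ => (classifyingMap H p).emb) p (Φ p ((ξ, w) : E × ℂ)) :
        (H →L[ℂ] H) × H).2 = proj (lineMap H p.1)
      (mfderiv (𝓘(ℝ, E).prod 𝓘(ℝ, ℂ)) 𝓘(ℝ, (H →L[ℂ] H) × H)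
      (fun p : X × ℂ => (classifyingMap H p).emb) p
        ((ξ, w) : TangentSpace (𝓘(ℝ, E).prod 𝓘(ℝ, ℂ)) p) : (H →L[ℂ] H) × H).2 :=
    congrArg (fun a : TautTangent H => a.2.2) h3
  have h6 : w' • kernelVector H p.1 =
      (w + p.2 * kernelForm κ p.1 (ξ : TangentSpace 𝓘(ℝ, E) p.1)) • kernelVector H p.1 := by
    refine Eq.trans ?_ (proj_lineMap_velocity hκ hk h0 p.1 p.2 ξ w)
    refine Eq.trans ?_ (h4.trans (congrArg (fun a : (H →L[ℂ] H) × H => proj (lineMap H p.1) a.2)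
      (mfderiv_emb_classifyingMap hk h0 p ξ w)))
    refine Eq.trans ?_ (congrArg Prod.snd ((congrArg
      (mfderiv (𝓘(ℝ, E).prod 𝓘(ℝ, ℂ)) 𝓘(ℝ, (H →L[ℂ] H) × H)
        (fun p : X × ℂ => (classifyingMap H p).emb) p) h2).trans
          (mfderiv_emb_classifyingMap_vertical hk h0 p w'))).symm
    rfl
  exact smul_left_injective ℂ (h0 p.1) h6

theorem IsInducedConnection.isLinear {κ : X → X → ℂ} (hκ : IsKernelOf κ H)
    (hk : ContMDiff 𝓘(ℝ, E) 𝓘(ℝ, H) ∞ (kernelVector H : X → H))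
    (h0 : ∀ x : X, kernelVector H x ≠ 0) {Φ : TangentOperators E X}
    (hΦ : IsInducedConnection H Φ) : IsLinear Φ := by
  intro x ξ c z z' w w'
  have h : ∀ z w : ℂ, (verticalPart (onTangent Φ (tangentPair x ξ z w))).2 =
      w + z * kernelForm κ x ξ := fun z w => congrArg Prod.snd (hΦ.apply_eq hκ hk h0 (x, z) ξ w)
  rw [h, h, h]
  ring

theorem IsInducedConnection.hasCovariantDerivative {κ : X → X → ℂ} (hκ : IsKernelOf κ H)
    (hk : ContMDiff 𝓘(ℝ, E) 𝓘(ℝ, H) ∞ (kernelVector H : X → H))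
    (h0 : ∀ x : X, kernelVector H x ≠ 0) {Φ : TangentOperators E X}
    (hΦ : IsInducedConnection H Φ) : HasCovariantDerivative Φ (kernelForm κ) := by
  intro W F hW hF x hx ξ
  have hd : MDifferentiableAt 𝓘(ℝ, E) 𝓘(ℝ, ℂ) F x :=
    ((hF x hx).contMDiffAt (hW.mem_nhds hx)).mdifferentiableAt (by simp)
  have h := (hasMFDerivAt_id (I := 𝓘(ℝ, E)) x).prodMk hd.hasMFDerivAt
  have h' : mfderiv 𝓘(ℝ, E) (𝓘(ℝ, E).prod 𝓘(ℝ, ℂ)) (fun x => (x, F x)) x ξ =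
      ((ξ, differential F x ξ) : E × ℂ) := by
    rw [show mfderiv 𝓘(ℝ, E) (𝓘(ℝ, E).prod 𝓘(ℝ, ℂ)) (fun x => (x, F x)) x = _ from h.mfderiv]
    rfl
  refine Prod.ext rfl ?_
  change (Φ (x, F x) (mfderiv 𝓘(ℝ, E) (𝓘(ℝ, E).prod 𝓘(ℝ, ℂ)) (fun x => (x, F x)) x ξ)).2 = _
  rw [h']
  exact congrArg Prod.snd (hΦ.apply_eq hκ hk h0 (x, F x) ξ (differential F x ξ))

end InducedConnection

/-! ### Positive definiteness of the classical kernels -/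

section PositiveDefinite

theorem sum_rank_one_nonneg {n : ℕ} (g v : Fin n → ℂ) :
    0 ≤ ∑ i, ∑ j, g i * conj (g j) * v j * conj (v i) := by
  have h : ∑ i, ∑ j, g i * conj (g j) * v j * conj (v i) =
      (∑ i, g i * conj (v i)) * star (∑ i, g i * conj (v i)) := by
    rw [star_sum, Finset.sum_mul_sum]
    refine Finset.sum_congr rfl fun i _ => Finset.sum_congr rfl fun j _ => ?_
    simp only [star_mul, Complex.star_def, Complex.conj_conj]
    ring
  rw [h]
  exact mul_star_self_nonneg _

/-- Power series with nonnegative coefficients in a Gram kernel are positive definite. -/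
theorem isPositiveDefinite_of_hasSum {X ι : Type*} [Fintype ι] {z : X → ι → ℂ} {c : ℕ → ℂ}
    (hc : ∀ n, 0 ≤ c n) {κ : X → X → ℂ}
    (h : ∀ x y, HasSum (fun n => c n * (∑ k, z x k * conj (z y k)) ^ n) (κ x y)) :
    IsPositiveDefinite κ := by
  intro n x v
  have hs : HasSum (fun m => ∑ i, ∑ j,
      c m * (∑ k, z (x i) k * conj (z (x j) k)) ^ m * v j * conj (v i))
      (∑ i, ∑ j, κ (x i) (x j) * v j * conj (v i)) :=
    hasSum_sum fun i _ => hasSum_sum fun j _ =>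
      ((h (x i) (x j)).mul_right (v j)).mul_right (conj (v i))
  refine hs.nonneg fun m => ?_
  -- Expanding the power over words `p` of length `m` writes it as a sum of rank-one kernels, each
  -- positive by `sum_rank_one_nonneg`.
  have hpow : ∀ i j, (∑ k, z (x i) k * conj (z (x j) k)) ^ m =
      ∑ p ∈ Fintype.piFinset fun _ : Fin m => Finset.univ,
        (∏ l, z (x i) (p l)) * conj (∏ l, z (x j) (p l)) := fun i j => by
    rw [Finset.sum_pow']
    simp only [Finset.prod_mul_distrib, map_prod]
  have hsum : ∑ i, ∑ j, c m * (∑ k, z (x i) k * conj (z (x j) k)) ^ m * v j * conj (v i) =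
      c m * ∑ p ∈ Fintype.piFinset fun _ : Fin m => Finset.univ, ∑ i, ∑ j,
        (∏ l, z (x i) (p l)) * conj (∏ l, z (x j) (p l)) * v j * conj (v i) := by
    simp_rw [hpow, Finset.mul_sum, Finset.sum_mul]
    symm
    rw [Finset.sum_comm]
    refine Finset.sum_congr rfl fun i _ => ?_
    rw [Finset.sum_comm]
    refine Finset.sum_congr rfl fun j _ => Finset.sum_congr rfl fun p _ => ?_
    ring
  rw [hsum]
  exact mul_nonneg (hc m) (Finset.sum_nonneg fun p _ => sum_rank_one_nonneg _ v)

/-- Positive definiteness is preserved under pull-backs and rescalings. -/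
theorem IsPositiveDefinite.rescale {X Y : Type*} {κ : X → X → ℂ} (hκ : IsPositiveDefinite κ)
    (ψ : Y → X) (g : Y → ℂ) :
    IsPositiveDefinite fun y y' => g y * conj (g y') * κ (ψ y) (ψ y') := by
  intro n y v
  refine (hκ n (fun i => ψ (y i)) (fun i => conj (g (y i)) * v i)).trans_eq ?_
  refine Finset.sum_congr rfl fun i _ => Finset.sum_congr rfl fun j _ => ?_
  simp only [map_mul, Complex.conj_conj]
  ring

/-- These are the coefficients `ν (ν + 1) ⋯ (ν + n - 1) / n!` of `(1 - u)^(-ν)`. Positivity is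
proved for real `ν` through the ascending Pochhammer polynomial and then cast to `ℂ`. -/
theorem choose_nonneg {ν : ℝ} (hν : 0 < ν) (n : ℕ) : 0 ≤ Ring.choose ((ν : ℂ) + n - 1) n := by
  rw [← Ring.multichoose_eq]
  have h : Ring.multichoose (ν : ℂ) n = ((Ring.multichoose ν n : ℝ) : ℂ) :=
    (Ring.map_multichoose Complex.ofRealHom ν n).symm
  rw [h, Complex.zero_le_real]
  have h1 := Ring.factorial_nsmul_multichoose_eq_ascPochhammer ν n
  have h2 := ascPochhammer_pos n ν hν
  rw [← Polynomial.ascPochhammer_smeval_eq_eval, ← h1, nsmul_eq_mul] at h2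
  exact (pos_of_mul_pos_right h2 (by positivity)).le

theorem norm_conj_mul_lt_one (s t : disk) : ‖conj (t : ℂ) * (s : ℂ)‖ < 1 := by
  have hs : ‖(s : ℂ)‖ < 1 := mem_ball_zero_iff.1 s.2
  have ht : ‖(t : ℂ)‖ < 1 := mem_ball_zero_iff.1 t.2
  rw [norm_mul, RCLike.norm_conj]
  nlinarith [norm_nonneg (s : ℂ), norm_nonneg (t : ℂ)]

theorem isPositiveDefinite_diskKernel {ν : ℝ} (hν : 1 ≤ ν) :
    IsPositiveDefinite (diskKernel ν) := by
  refine isPositiveDefinite_of_hasSum (z := fun (s : disk) (_ : Fin 1) => (s : ℂ))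
    (c := fun n => Ring.choose ((ν : ℂ) + n - 1) n) (choose_nonneg (by linarith)) fun s t => ?_
  have h := (Complex.one_div_one_sub_cpow_hasFPowerSeriesOnBall_zero (ν : ℂ)).hasSum
    (y := conj (t : ℂ) * (s : ℂ)) (by
      rw [← ENNReal.ofReal_one, Metric.eball_ofReal]
      simpa using norm_conj_mul_lt_one s t)
  simp only [FormalMultilinearSeries.ofScalars_apply_eq, smul_eq_mul, zero_add] at h
  simp only [Fin.sum_univ_one, mul_comm (s : ℂ)]
  exact h

theorem isPositiveDefinite_fockKernel (n : ℕ) : IsPositiveDefinite (fockKernel n) := by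
  refine isPositiveDefinite_of_hasSum (z := fun z k => z k) (c := fun m => ((m.factorial : ℂ))⁻¹)
    (fun m => ?_) fun z w => ?_
  · rw [← Complex.ofReal_natCast, ← Complex.ofReal_inv, Complex.zero_le_real]
    positivity
  · rw [fockKernel, Complex.exp_eq_exp_ℂ]
    have := NormedSpace.exp_series_hasSum_exp' (𝕂 := ℂ) (∑ k, z k * conj (w k))
    exact this

/-! ### Principal powers and the transfer from the disk to the half-plane -/

/-- Both arguments lie in `(-π/2, π/2)`, so their sum stays in the principal range and logarithms
add. -/
theorem mul_cpow_of_re_pos {a b : ℂ} (ha : 0 < a.re) (hb : 0 < b.re) (c : ℂ) :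
    (a * b) ^ c = a ^ c * b ^ c := by
  have ha0 : a ≠ 0 := by rintro rfl; simp at ha
  have hb0 : b ≠ 0 := by rintro rfl; simp at hb
  have h1 := abs_lt.1 (Complex.abs_arg_lt_pi_div_two_iff.2 (Or.inl ha))
  have h2 := abs_lt.1 (Complex.abs_arg_lt_pi_div_two_iff.2 (Or.inl hb))
  rw [Complex.cpow_def_of_ne_zero (mul_ne_zero ha0 hb0), Complex.cpow_def_of_ne_zero ha0,
    Complex.cpow_def_of_ne_zero hb0,
    Complex.log_mul ha0 hb0 ⟨by linarith, by linarith⟩, add_mul, Complex.exp_add]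

theorem arg_ne_pi_of_re_pos {a : ℂ} (ha : 0 < a.re) : a.arg ≠ Real.pi := by
  have h1 := abs_lt.1 (Complex.abs_arg_lt_pi_div_two_iff.2 (Or.inl ha))
  linarith [Real.pi_pos]

/-- Here `2i` has argument `π/2`, so the sum of arguments lies in `(0, π)`. -/
theorem two_I_mul_cpow_of_re_pos {a : ℂ} (ha : 0 < a.re) (c : ℂ) :
    (2 * Complex.I * a) ^ c = (2 * Complex.I) ^ c * a ^ c := by
  have ha0 : a ≠ 0 := by rintro rfl; simp at ha
  have h1 := abs_lt.1 (Complex.abs_arg_lt_pi_div_two_iff.2 (Or.inl ha))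
  have h0 : (2 * Complex.I) ≠ 0 := by simp
  have h2 : (2 * Complex.I).arg = Real.pi / 2 := by
    rw [← Complex.ofReal_ofNat, Complex.arg_real_mul _ two_pos, Complex.arg_I]
  rw [Complex.cpow_def_of_ne_zero (mul_ne_zero h0 ha0), Complex.cpow_def_of_ne_zero ha0,
    Complex.cpow_def_of_ne_zero h0,
    Complex.log_mul h0 ha0 (by rw [h2]; exact ⟨by linarith [Real.pi_pos], by linarith⟩),
    add_mul, Complex.exp_add]

/-- The Cayley transform from the upper half-plane to the disk. -/
def cayley (z : halfPlane) : disk :=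
  ⟨((z : ℂ) - Complex.I) / (z + Complex.I), by
    have hz : 0 < (z : ℂ).im := z.2
    have h : ‖(z : ℂ) - Complex.I‖ < ‖(z : ℂ) + Complex.I‖ := by
      rw [← sq_lt_sq₀ (norm_nonneg _) (norm_nonneg _), ← Complex.normSq_eq_norm_sq,
        ← Complex.normSq_eq_norm_sq, Complex.normSq_apply, Complex.normSq_apply]
      simp
      nlinarith
    change _ ∈ Metric.ball (0 : ℂ) 1
    rw [mem_ball_zero_iff, norm_div]
    exact (div_lt_one ((norm_nonneg _).trans_lt h)).2 h⟩

/-- The identity `z - w̄ = 2i · a · b̄ · q`, with `a = (z + i)/(2i)`, `b = (w + i)/(2i)` and `q` the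
base of the disk kernel at the Cayley images, is raised to the power `-ν`. The constant `1/4` splits
into the two factors `1/2`. -/
theorem halfPlaneKernel_eq (ν : ℝ) (z w : halfPlane) :
    halfPlaneKernel ν z w =
      (1 / 2 * ((((z : ℂ) + Complex.I) / (2 * Complex.I)) ^ (ν : ℂ))⁻¹) *
        conj (1 / 2 * ((((w : ℂ) + Complex.I) / (2 * Complex.I)) ^ (ν : ℂ))⁻¹) *
          diskKernel ν (cayley z) (cayley w) := by
  have hre : ∀ u : ℂ, (u / (2 * Complex.I)).re = u.im / 2 := fun u => by
    rw [div_mul_eq_div_div, Complex.div_I]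
    simp
  have hz : 0 < (z : ℂ).im := z.2
  have hw : 0 < (w : ℂ).im := w.2
  set a := ((z : ℂ) + Complex.I) / (2 * Complex.I) with ha
  set b := ((w : ℂ) + Complex.I) / (2 * Complex.I) with hb
  set d := ((z : ℂ) - conj (w : ℂ)) / (2 * Complex.I) with hd
  set q := 1 - conj (cayley w : ℂ) * (cayley z : ℂ) with hq
  have hare : 0 < a.re := by rw [ha, hre]; simp; linarith
  have hbre : 0 < b.re := by rw [hb, hre]; simp; linarith
  have hdre : 0 < d.re := by rw [hd, hre]; simp; linarith
  have hqre : 0 < q.re := by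
    have h := (Complex.abs_re_le_norm _).trans_lt (norm_conj_mul_lt_one (cayley z) (cayley w))
    rw [hq, Complex.sub_re, Complex.one_re]
    linarith [(abs_lt.1 h).2]
  have hz0 : (z : ℂ) + Complex.I ≠ 0 := fun h => by
    have := congrArg Complex.im h
    simp at this
    linarith
  have hw0 : conj (w : ℂ) - Complex.I ≠ 0 := fun h => by
    have := congrArg Complex.im h
    simp at this
    linarith
  have ha0 : a ≠ 0 := by intro h; simp [h] at hare
  -- Each side has just two factors, all with positive real part, so principal powers split on both
  -- sides; a product of three such factors could leave the principal range.
  have hprod : a⁻¹ * d = conj b * q := by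
    simp only [ha, hb, hd, hq, cayley, map_div₀, map_sub, map_add, map_mul, Complex.conj_I,
      map_ofNat, ← sub_eq_add_neg, sub_neg_eq_add]
    field_simp
    ring_nf
  have hainv : 0 < a⁻¹.re := by
    rw [Complex.inv_re]
    exact div_pos hare (Complex.normSq_pos.2 ha0)
  have hcb : 0 < (conj b).re := by simpa using hbre
  have hpow := congrArg (fun u : ℂ => u ^ (ν : ℂ)) hprod
  simp only [mul_cpow_of_re_pos hainv hdre, mul_cpow_of_re_pos hcb hqre,
    Complex.inv_cpow _ _ (arg_ne_pi_of_re_pos hare),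
    Complex.conj_cpow _ _ (arg_ne_pi_of_re_pos hbre), Complex.conj_ofReal] at hpow
  have hzw : (z : ℂ) - conj (w : ℂ) = 2 * Complex.I * d := by
    rw [hd]
    field_simp
  have hne : ∀ {u : ℂ}, 0 < u.re → u ^ (ν : ℂ) ≠ 0 := fun {u} hu =>
    Complex.cpow_ne_zero_iff.2 (Or.inl fun h => by simp [h] at hu)
  have hI : (2 * Complex.I) ^ (ν : ℂ) ≠ 0 := Complex.cpow_ne_zero_iff.2 (Or.inl (by simp))
  have h1 := hne hare
  have h2 := hne hdre
  have h3 : conj (b ^ (ν : ℂ)) ≠ 0 := (map_ne_zero _).2 (hne hbre)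
  have h4 := hne hqre
  rw [halfPlaneKernel, diskKernel, hzw, two_I_mul_cpow_of_re_pos hdre, ← hq]
  simp only [map_mul, map_inv₀, map_div₀, map_one, map_ofNat]
  have h5 : d ^ (ν : ℂ) = a ^ (ν : ℂ) * (conj (b ^ (ν : ℂ)) * q ^ (ν : ℂ)) := by
    rw [← hpow, mul_inv_cancel_left₀ h1]
  rw [h5]
  field_simp
  ring

theorem isPositiveDefinite_halfPlaneKernel {ν : ℝ} (hν : 1 ≤ ν) :
    IsPositiveDefinite (halfPlaneKernel ν) := by
  have h := (isPositiveDefinite_diskKernel hν).rescale cayley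
    (fun z => 1 / 2 * ((((z : ℂ) + Complex.I) / (2 * Complex.I)) ^ (ν : ℂ))⁻¹)
  convert h using 3 with z w
  exact halfPlaneKernel_eq ν z w

end PositiveDefinite

/-! ### Smoothness and differential forms of the classical kernels -/

section ClassicalForms

open TopologicalSpace (Opens)

/-- The charts of an open submanifold are restrictions of the identity chart, so the inclusion reads
as the identity near the point. -/
theorem hasMFDerivAt_opens_val {E : Type*} [NormedAddCommGroup E] [NormedSpace ℝ E] {U : Opens E}
    (x : U) :
    HasMFDerivAt 𝓘(ℝ, E) 𝓘(ℝ, E) (Subtype.val : U → E) x (ContinuousLinearMap.id ℝ E) := by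
  refine ⟨continuous_subtype_val.continuousAt, ?_⟩
  have h := TopologicalSpace.Opens.chartAt_subtype_val_symm_eventuallyEq (H := E) U (x := x)
  have h' : writtenInExtChartAt 𝓘(ℝ, E) 𝓘(ℝ, E) x (Subtype.val : U → E) =ᶠ[nhds (x : E)] id := by
    filter_upwards [h] with y hy
    exact hy.symm
  refine HasFDerivAt.hasFDerivWithinAt ?_
  exact (hasFDerivAt_id (x : E)).congr_of_eventuallyEq h'

theorem differential_comp_opens_val {E : Type*} [NormedAddCommGroup E] [NormedSpace ℝ E]
    {U : Opens E} {x : U} {f : E → ℂ} {f' : E →L[ℝ] ℂ} (hf : HasFDerivAt f f' (x : E)) (ξ : E) :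
    differential (fun y : U => f y) x (ξ : TangentSpace 𝓘(ℝ, E) x) = f' ξ := by
  have h := HasMFDerivAt.comp (f := (Subtype.val : U → E)) x hf.hasMFDerivAt
    (hasMFDerivAt_opens_val x)
  change mfderiv 𝓘(ℝ, E) 𝓘(ℝ, ℂ) (f ∘ (Subtype.val : U → E)) x ξ = _
  rw [h.mfderiv]
  rfl

/-- The form of a kernel that is a negative power of a sesqui-holomorphic function. -/
theorem kernelForm_cpow {U : Opens ℂ} {κ : U → U → ℂ} {x : U} {C ν : ℂ} {u : ℂ → ℂ} {u' : ℂ}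
    (hκ : ∀ y : U, κ x y = C * (1 / u (conj (y : ℂ)) ^ ν)) (hC : C ≠ 0)
    (hu : HasDerivAt u u' (conj (x : ℂ))) (hs : u (conj (x : ℂ)) ∈ Complex.slitPlane) (ξ : ℂ) :
    kernelForm κ x (ξ : TangentSpace 𝓘(ℝ, ℂ) x) = -ν * u' / u (conj (x : ℂ)) * conj ξ := by
  have hu0 : u (conj (x : ℂ)) ≠ 0 := Complex.slitPlane_ne_zero hs
  have hp0 : u (conj (x : ℂ)) ^ ν ≠ 0 := Complex.cpow_ne_zero_iff.2 (Or.inl hu0)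
  have h1 := ((hu.cpow_const (c := ν) hs).inv hp0).const_mul C
  have h2 : HasFDerivAt (𝕜 := ℝ) (fun y : ℂ => conj y) (Complex.conjCLE : ℂ →L[ℝ] ℂ) (x : ℂ) :=
    Complex.conjCLE.hasFDerivAt
  -- In its second variable the kernel is a holomorphic function of the conjugate, so the derivative
  -- is a complex number times `conj ξ`; division by `κ x x` then cancels `C` and leaves a
  -- logarithmic derivative.
  have h3 := HasFDerivAt.comp (f := fun y : ℂ => conj y) (x : ℂ)
    (h1.hasFDerivAt.restrictScalars ℝ) h2
  have h4 := differential_comp_opens_val h3 ξ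
  have h5 : (fun y : U => κ x y) = fun y : U =>
      ((fun w => C * ((fun w => u w ^ ν)⁻¹) w) ∘ fun y : ℂ => conj y) (y : ℂ) := by
    funext y
    rw [hκ, one_div]
    rfl
  change differential (fun y => κ x y) x ξ / κ x x = _
  rw [h5, h4, hκ]
  have h6 : ∀ a : ℂ, (((ContinuousLinearMap.toSpanSingleton ℂ a).restrictScalars ℝ).comp
      (Complex.conjCLE : ℂ →L[ℝ] ℂ)) ξ = conj ξ * a := fun a => rfl
  refine (congrArg (· / _) (h6 _)).trans ?_
  rw [Complex.cpow_sub _ _ hu0, Complex.cpow_one]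
  field_simp

/-- Smoothness of negative powers of smooth functions with values in the slit plane. -/
theorem isSmoothKernel_cpow {U : Opens ℂ} {κ : U → U → ℂ} {C ν : ℂ} {u : ℂ × ℂ → ℂ}
    (hκ : ∀ x y : U, κ x y = C * (1 / u (x, y) ^ ν)) (hu : ContDiff ℝ ∞ u)
    (hs : ∀ x y : U, u (x, y) ∈ Complex.slitPlane) : IsSmoothKernel ℂ κ := by
  intro p
  -- The power is written as `exp (-ν log)`, which is complex smooth on the slit plane; restricting
  -- scalars allows composition with the merely real smooth `u`.
  have h1 : ContDiffAt ℂ ∞ (fun w : ℂ => C * Complex.exp (-(Complex.log w * ν)))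
      (u (p.1, p.2)) :=
    contDiffAt_const.mul
      (((Complex.contDiffAt_log (hs p.1 p.2)).mul contDiffAt_const).neg.cexp)
  have h2 : ContDiffAt ℝ ∞ ((fun w : ℂ => C * Complex.exp (-(Complex.log w * ν))) ∘ u)
      ((p.1 : ℂ), (p.2 : ℂ)) := (h1.restrict_scalars ℝ).comp _ hu.contDiffAt
  have h3 : ContMDiff (𝓘(ℝ, ℂ).prod 𝓘(ℝ, ℂ)) 𝓘(ℝ, ℂ × ℂ) ∞
      (fun p : U × U => ((p.1 : ℂ), (p.2 : ℂ))) :=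
    (contMDiff_subtype_val.comp contMDiff_fst).prodMk_space
      (contMDiff_subtype_val.comp contMDiff_snd)
  refine (ContMDiffAt.comp (f := fun p : U × U => ((p.1 : ℂ), (p.2 : ℂ))) p h2.contMDiffAt
    (h3 p)).congr_of_eventuallyEq (Filter.Eventually.of_forall fun q => ?_)
  simp only [hκ, Function.comp_apply]
  rw [Complex.cpow_def_of_ne_zero (Complex.slitPlane_ne_zero (hs q.1 q.2)), Complex.exp_neg,
    one_div]

theorem one_sub_conj_mul_mem_slitPlane (s t : disk) :
    1 - conj (t : ℂ) * (s : ℂ) ∈ Complex.slitPlane := by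
  have h := (Complex.abs_re_le_norm _).trans_lt (norm_conj_mul_lt_one s t)
  refine Or.inl ?_
  rw [Complex.sub_re, Complex.one_re]
  linarith [(abs_lt.1 h).2]

theorem sub_conj_mem_slitPlane (z w : halfPlane) :
    (z : ℂ) - conj (w : ℂ) ∈ Complex.slitPlane := by
  have hz : 0 < (z : ℂ).im := z.2
  have hw : 0 < (w : ℂ).im := w.2
  refine Or.inr ?_
  simp
  linarith

theorem contDiff_conj : ContDiff ℝ ∞ (fun z : ℂ => conj z) := Complex.conjCLE.contDiff

theorem isSmoothKernel_diskKernel (ν : ℝ) : IsSmoothKernel ℂ (diskKernel ν) :=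
  isSmoothKernel_cpow (C := 1) (ν := ν) (u := fun p => 1 - conj p.2 * p.1)
    (fun s t => by rw [diskKernel, one_mul])
    (contDiff_const.sub ((contDiff_conj.comp contDiff_snd).mul contDiff_fst))
    one_sub_conj_mul_mem_slitPlane

theorem halfPlaneKernel_eq_mul (ν : ℝ) (z w : halfPlane) : halfPlaneKernel ν z w =
    1 / 4 * (2 * Complex.I) ^ (ν : ℂ) * (1 / ((z : ℂ) - conj (w : ℂ)) ^ (ν : ℂ)) := by
  rw [halfPlaneKernel]
  ring

theorem isSmoothKernel_halfPlaneKernel (ν : ℝ) : IsSmoothKernel ℂ (halfPlaneKernel ν) :=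
  isSmoothKernel_cpow (ν := ν) (u := fun p => p.1 - conj p.2) (halfPlaneKernel_eq_mul ν)
    (contDiff_fst.sub (contDiff_conj.comp contDiff_snd)) sub_conj_mem_slitPlane

theorem diskKernel_self_ne_zero (ν : ℝ) (s : disk) : diskKernel ν s s ≠ 0 :=
  one_div_ne_zero (Complex.cpow_ne_zero_iff.2
    (Or.inl (Complex.slitPlane_ne_zero (one_sub_conj_mul_mem_slitPlane s s))))

theorem quarter_two_I_cpow_ne_zero (ν : ℝ) : (1 / 4 * (2 * Complex.I) ^ (ν : ℂ) : ℂ) ≠ 0 :=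
  mul_ne_zero (by norm_num) (Complex.cpow_ne_zero_iff.2 (Or.inl (by simp)))

theorem halfPlaneKernel_self_ne_zero (ν : ℝ) (z : halfPlane) : halfPlaneKernel ν z z ≠ 0 := by
  rw [halfPlaneKernel_eq_mul]
  exact mul_ne_zero (quarter_two_I_cpow_ne_zero ν) (one_div_ne_zero (Complex.cpow_ne_zero_iff.2
    (Or.inl (Complex.slitPlane_ne_zero (sub_conj_mem_slitPlane z z)))))

theorem kernelForm_diskKernel (ν : ℝ) (s : disk) (l : ℂ) :
    kernelForm (diskKernel ν) s (l : TangentSpace 𝓘(ℝ, ℂ) s) =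
      ν * (s : ℂ) / (1 - (‖(s : ℂ)‖ : ℂ) ^ 2) * conj l := by
  have hu : HasDerivAt (fun w : ℂ => 1 - w * (s : ℂ)) (-(s : ℂ)) (conj (s : ℂ)) := by
    simpa using ((hasDerivAt_id (conj (s : ℂ))).mul_const (s : ℂ)).const_sub 1
  rw [kernelForm_cpow (C := 1) (ν := ν) (u := fun w => 1 - w * (s : ℂ))
    (fun t => by rw [diskKernel, one_mul]) one_ne_zero hu (one_sub_conj_mul_mem_slitPlane s s),
    Complex.conj_mul']
  ring

theorem kernelForm_halfPlaneKernel (ν : ℝ) (z : halfPlane) (l : ℂ) :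
    kernelForm (halfPlaneKernel ν) z (l : TangentSpace 𝓘(ℝ, ℂ) z) =
      ν / (2 * Complex.I * ((z : ℂ).im : ℂ)) * conj l := by
  have hu : HasDerivAt (fun w : ℂ => (z : ℂ) - w) (-1) (conj (z : ℂ)) := by
    simpa using (hasDerivAt_id (conj (z : ℂ))).const_sub (z : ℂ)
  rw [kernelForm_cpow (ν := ν) (u := fun w => (z : ℂ) - w) (halfPlaneKernel_eq_mul ν z)
    (quarter_two_I_cpow_ne_zero ν) hu (sub_conj_mem_slitPlane z z), Complex.sub_conj]
  push_cast
  ring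

theorem hasFDerivAt_fock {n : ℕ} (z w : EuclideanSpace ℂ (Fin n)) :
    HasFDerivAt (𝕜 := ℝ) (fun w : EuclideanSpace ℂ (Fin n) => ∑ j, z j * conj (w j))
      (∑ j, (ContinuousLinearMap.mul ℝ ℂ (z j)).comp ((Complex.conjCLE : ℂ →L[ℝ] ℂ).comp
        ((EuclideanSpace.proj j : EuclideanSpace ℂ (Fin n) →L[ℂ] ℂ).restrictScalars ℝ))) w := by
  refine HasFDerivAt.fun_sum fun j _ => ?_
  exact ((ContinuousLinearMap.mul ℝ ℂ (z j)).comp ((Complex.conjCLE : ℂ →L[ℝ] ℂ).comp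
    ((EuclideanSpace.proj j : EuclideanSpace ℂ (Fin n) →L[ℂ] ℂ).restrictScalars ℝ))).hasFDerivAt

theorem kernelForm_fockKernel {n : ℕ} (z l : EuclideanSpace ℂ (Fin n)) :
    kernelForm (fockKernel n) z (l : TangentSpace 𝓘(ℝ, EuclideanSpace ℂ (Fin n)) z) =
      ∑ j, z j * conj (l j) := by
  have h := (hasFDerivAt_fock z z).cexp
  have h' : differential (fun w => fockKernel n z w) z
      (l : TangentSpace 𝓘(ℝ, EuclideanSpace ℂ (Fin n)) z) =
        fockKernel n z z * ∑ j, z j * conj (l j) := by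
    change mfderiv 𝓘(ℝ, EuclideanSpace ℂ (Fin n)) 𝓘(ℝ, ℂ) (fun w => fockKernel n z w) z l = _
    rw [mfderiv_eq_fderiv, show fderiv ℝ (fun w => fockKernel n z w) z = _ from h.fderiv]
    exact congrArg (fockKernel n z z * ·)
      ((sum_apply (F := EuclideanSpace ℂ (Fin n) →L[ℝ] ℂ) _ _ l).trans rfl)
  change differential (fun w => fockKernel n z w) z l / fockKernel n z z = _
  rw [h', mul_div_cancel_left₀]
  exact Complex.exp_ne_zero _

theorem isSmoothKernel_fockKernel (n : ℕ) :
    IsSmoothKernel (EuclideanSpace ℂ (Fin n)) (fockKernel n) := by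
  have hp : ∀ j, ContDiff ℝ ∞ (fun z : EuclideanSpace ℂ (Fin n) => z j) := fun j =>
    ((EuclideanSpace.proj j : EuclideanSpace ℂ (Fin n) →L[ℂ] ℂ).restrictScalars ℝ).contDiff
  have h : ContDiff ℝ ∞ (fun p : EuclideanSpace ℂ (Fin n) × EuclideanSpace ℂ (Fin n) =>
      fockKernel n p.1 p.2) :=
    (ContDiff.sum fun j _ => ((hp j).comp contDiff_fst).mul
      (contDiff_conj.comp ((hp j).comp contDiff_snd))).cexp
  rw [IsSmoothKernel, ← modelWithCornersSelf_prod, chartedSpaceSelf_prod]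
  exact h.contMDiff

end ClassicalForms

/-- The covariant derivative of every connection induced by a smooth kernel. -/
theorem hasCovariantDerivative_of_isSmoothKernel {E : Type*} [NormedAddCommGroup E]
    [NormedSpace ℝ E] {X : Type*} [TopologicalSpace X] [ChartedSpace E X] [IsManifold 𝓘(ℝ, E) ∞ X]
    {κ : X → X → ℂ} (hs : IsSmoothKernel E κ) (h0 : ∀ x, κ x x ≠ 0)
    {H : Type*} [NormedAddCommGroup H] [InnerProductSpace ℂ H] [CompleteSpace H] [RKHS ℂ H X ℂ]
    (hκ : IsKernelOf κ H) {Φ : TangentOperators E X} (hΦ : IsInducedConnection H Φ) :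
    HasCovariantDerivative Φ (kernelForm κ) :=
  hΦ.hasCovariantDerivative hκ (hs.contMDiff_kernelVector hκ)
    fun x => hκ.kernelVector_ne_zero (h0 x)

end KernelConnection

end

/-! ### The general formula and the three classical families -/

open KernelConnection in
theorem proposition5p1 :
    -- the general formula
    (∀ (E : Type*) [NormedAddCommGroup E] [NormedSpace ℝ E] [CompleteSpace E]
      (X : Type*) [TopologicalSpace X] [ChartedSpace E X] [IsManifold 𝓘(ℝ, E) ∞ X]
      (κ : X → X → ℂ), IsPositiveDefinite κ → IsSmoothKernel E κ → (∀ x, κ x x ≠ 0) →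
      ∀ (H : Type*) [NormedAddCommGroup H] [InnerProductSpace ℂ H] [CompleteSpace H]
        [RKHS ℂ H X ℂ], IsKernelOf κ H →
        (∃! Φ : TangentOperators E X, IsInducedConnection H Φ) ∧
        ContMDiff 𝓘(ℝ, E).tangent 𝓘(ℝ, ℂ) ∞
          (fun v : TangentBundle 𝓘(ℝ, E) X => kernelForm κ v.1 v.2) ∧
        ∀ Φ : TangentOperators E X, IsInducedConnection H Φ →
          IsLinear Φ ∧ HasCovariantDerivative Φ (kernelForm κ)) ∧
    -- Hardy and Bergman kernels on the disk
    (∀ ν : ℝ, 1 ≤ ν →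
      IsPositiveDefinite (diskKernel ν) ∧ IsSmoothKernel ℂ (diskKernel ν) ∧
      (∀ s, diskKernel ν s s ≠ 0) ∧
      ∀ (H : Type*) [NormedAddCommGroup H] [InnerProductSpace ℂ H] [CompleteSpace H]
        [RKHS ℂ H disk ℂ], IsKernelOf (diskKernel ν) H →
        ∀ Φ : TangentOperators ℂ disk, IsInducedConnection H Φ →
          HasCovariantDerivative Φ
            (fun (s : disk) (l : ℂ) => ν * (s : ℂ) / (1 - (‖(s : ℂ)‖ : ℂ) ^ 2) * conj l)) ∧
    -- Hardy and Bergman kernels on the upper half-plane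
    (∀ ν : ℝ, 1 ≤ ν →
      IsPositiveDefinite (halfPlaneKernel ν) ∧ IsSmoothKernel ℂ (halfPlaneKernel ν) ∧
      (∀ z, halfPlaneKernel ν z z ≠ 0) ∧
      ∀ (H : Type*) [NormedAddCommGroup H] [InnerProductSpace ℂ H] [CompleteSpace H]
        [RKHS ℂ H halfPlane ℂ], IsKernelOf (halfPlaneKernel ν) H →
        ∀ Φ : TangentOperators ℂ halfPlane, IsInducedConnection H Φ →
          HasCovariantDerivative Φ
            (fun (z : halfPlane) (l : ℂ) =>
              ν / (2 * Complex.I * ((z : ℂ).im : ℂ)) * conj l)) ∧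
    -- Fock kernel on `ℂⁿ`
    (∀ n : ℕ,
      IsPositiveDefinite (fockKernel n) ∧ IsSmoothKernel (EuclideanSpace ℂ (Fin n)) (fockKernel n) ∧
      (∀ z, fockKernel n z z ≠ 0) ∧
      ∀ (H : Type*) [NormedAddCommGroup H] [InnerProductSpace ℂ H] [CompleteSpace H]
        [RKHS ℂ H (EuclideanSpace ℂ (Fin n)) ℂ], IsKernelOf (fockKernel n) H →
        ∀ Φ : TangentOperators (EuclideanSpace ℂ (Fin n)) (EuclideanSpace ℂ (Fin n)),
          IsInducedConnection H Φ →
          HasCovariantDerivative Φ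
            (fun (z l : EuclideanSpace ℂ (Fin n)) => ∑ j, z j * conj (l j))) := by
  refine ⟨?_, fun ν hν => ⟨isPositiveDefinite_diskKernel hν, isSmoothKernel_diskKernel ν,
    diskKernel_self_ne_zero ν, ?_⟩, fun ν hν => ⟨isPositiveDefinite_halfPlaneKernel hν,
    isSmoothKernel_halfPlaneKernel ν, halfPlaneKernel_self_ne_zero ν, ?_⟩, fun n =>
    ⟨isPositiveDefinite_fockKernel n, isSmoothKernel_fockKernel n,
    fun _ => Complex.exp_ne_zero _, ?_⟩⟩
  · intro E _ _ _ X _ _ _ κ _ hs h0 H _ _ _ _ hκ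
    have hk := hs.contMDiff_kernelVector hκ
    have hk0 : ∀ x, kernelVector H x ≠ 0 := fun x => hκ.kernelVector_ne_zero (h0 x)
    refine ⟨⟨formConnection κ, isInducedConnection_formConnection hκ hk hk0, fun Φ hΦ => ?_⟩,
      kernelForm_smooth hκ hk hk0, fun Φ hΦ =>
      ⟨hΦ.isLinear hκ hk hk0, hΦ.hasCovariantDerivative hκ hk hk0⟩⟩
    funext p
    refine ContinuousLinearMap.ext fun v => ?_
    exact (hΦ.apply_eq hκ hk hk0 p v.1 v.2).trans (formConnection_apply κ p v.1 v.2).symm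
  · intro H _ _ _ _ hκ Φ hΦ
    have h := hasCovariantDerivative_of_isSmoothKernel (isSmoothKernel_diskKernel ν)
      (diskKernel_self_ne_zero ν) hκ hΦ
    rwa [show kernelForm (diskKernel ν) = _ from
      funext fun s => funext fun l => kernelForm_diskKernel ν s l] at h
  · intro H _ _ _ _ hκ Φ hΦ
    have h := hasCovariantDerivative_of_isSmoothKernel (isSmoothKernel_halfPlaneKernel ν)
      (halfPlaneKernel_self_ne_zero ν) hκ hΦ
    rwa [show kernelForm (halfPlaneKernel ν) = _ from
      funext fun z => funext fun l => kernelForm_halfPlaneKernel ν z l] at h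
  · intro H _ _ _ _ hκ Φ hΦ
    have h := hasCovariantDerivative_of_isSmoothKernel (isSmoothKernel_fockKernel n)
      (fun _ => Complex.exp_ne_zero _) hκ hΦ
    rwa [show kernelForm (fockKernel n) = _ from
      funext fun z => funext fun l => kernelForm_fockKernel z l] at h
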